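/- **Setting.** Let $N\ge 3$ and let $\Omega\subset\mathbb R^N$ be a bounded domain with smooth boundary; $(\cdot,\cdot)$ and $\|\cdot\|$ denote the inner product and norm of $L^2(\Omega)$, and $\lambda_1$ the first eigenvalue of $-\Delta$ on $\Omega$ with homogeneous Dirichlet conditions. Consider, for $\tau\in\mathbb R$, $\xi>0$, $$u_t-\varepsilon(t)\Delta u_t-a(l(u))\Delta u=f(u)+\xi h(x,t)\ \text{ in }\Omega\times(\tau,\infty),\qquad u=0\ \text{ on }\partial\Omega\times(\tau,\infty),\qquad u(\cdot,\tau)=u_\tau .\tag{1}$$ Assume: * $\varepsilon\in C^1(\mathbb R)$ is decreasing and positive, $\lim_{t\to+\infty}\varepsilon(t)=0$, and $\sup_{t\in\mathbb R}(|\varepsilon(t)|+|\varepsilon'(t)|)<\infty$; * $a:\mathbb R\to\mathbb R$ is locally Lipschitz and $0<m\le a(s)\le M$ for all $s$, with constants $m,M$; $l(u)=\int_\Omega g\,u\,dx$ with $g\in L^2(\Omega)$; * $f\in C(\mathbb R)$, $0\le p\le\frac4{N-2}$, $|f(u)-f(v)|\le C(|u|^p+|v|^p+1)|u-v|$ for all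 $u,v\in\mathbb R$, and $\limsup_{|s|\to\infty}f(s)/s<\lambda_1$; * $f=f_0+f_1$ with $f_0,f_1\in C(\mathbb R)$, $|f_0(s)|\le C(|s|^{p+1}+|s|)$ and $|f_1(s)|\le C(|s|^{p+1}+1)$ for all $s\in\mathbb R$, and $$(f_0(u),u)\le\Big(2a(l(u))-\varepsilon'(t)-\tfrac{\lambda_1}{\lambda_1+1}\varepsilon(t)\Big)\|\nabla u\|^2-\tfrac{\lambda_1}{\lambda_1+1}\|u\|^2\qquad\text{for all }t\in\mathbb R,\ u\in H_0^1(\Omega);$$ * $h\in L^2_{\rm loc}(\mathbb R;L^2(\Omega))$. Let $\mathcal H_t(\Omega)$ be $H_0^1(\Omega)$ with the norm $\|u\|_{\mathcal H_t}^2=\|u\|^2+\varepsilon(t)\|\nabla u\|^2$. Let $\kappa\in\{1,2\}$. A weak solution with initial value $u_\tau\in\mathcal H_\tau(\Omega)$ is a function $u\in C([\tau,T];\mathcal H_t(\Omega))$ for all $T>\tau$, with $u(\tau)=u_\tau$, such that for every $\varphi\in H_0^1(\Omega)$, in the sense of distributions on $(\tau,\infty)$, $$\frac{d}{dt}\big[(u,\varphi)+\varepsilon(t)(\nabla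 u,\nabla\varphi)\big]+\big(\kappa\,a(l(u))-\varepsilon'(t)\big)(\nabla u,\nabla\varphi)=\kappa\,(f(u),\varphi)+\kappa\,\xi\,(h(t),\varphi).$$ For $\kappa=1$ this is the weak form of (1); for $\kappa=2$ it is the same identity with $a$, $f$ and $h$ doubled. **Theorem.** Under these assumptions, for $\kappa=1$ as well as for $\kappa=2$: (i) the weak solution is unique: if $u^1,u^2$ are weak solutions with the same initial value $u_\tau$, then $u^1(t)=u^2(t)$ for all $t\ge\tau$; (ii) for all $T\ge\tau$ and $R$ there is a constant $C$ such that any two weak solutions $u^1,u^2$ with initial values $u^1_\tau,u^2_\tau$ satisfying $\|u^i_\tau\|^2_{\mathcal H_\tau}\le R$ obey $$\|u^1(t)-u^2(t)\|^2_{\mathcal H_t}\le e^{C(t-\tau)}\|u^1_\tau-u^2_\tau\|^2_{\mathcal H_\tau},\qquad \tau\le t\le T .$$ -/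

import Mathlib

open MeasureTheory Filter Topology Set
open scoped ContDiff

noncomputable section

namespace NonlocalDiffusion

/-- `ℝ^N` with its Euclidean norm. -/
abbrev Space (N : ℕ) : Type := EuclideanSpace ℝ (Fin N)

/-- The real Hilbert space `L²(Ω)`. -/
abbrev L2 {N : ℕ} (Ω : Set (Space N)) : Type :=
  Lp ℝ 2 (volume.restrict Ω)

/-- The real Hilbert space `L²(Ω; ℝ^N)`. -/
abbrev L2Vec {N : ℕ} (Ω : Set (Space N)) : Type :=
  Lp (Space N) 2 (volume.restrict Ω)

/-- The boundary of `Ω` is smooth: near each boundary point, `Ω` is the set where a smooth function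
without critical points is negative (so that `Ω` lies locally on one side of its boundary). -/
def HasSmoothBoundary {N : ℕ} (Ω : Set (Space N)) : Prop :=
  ∀ x ∈ frontier Ω, ∃ U : Set (Space N), IsOpen U ∧ x ∈ U ∧
    ∃ ρ : Space N → ℝ, ContDiffOn ℝ ∞ ρ U ∧ (∀ y ∈ U, fderiv ℝ ρ y ≠ 0) ∧
      Ω ∩ U = {y | y ∈ U ∧ ρ y < 0}

/-- The pairs `(φ, ∇φ)` in `L²(Ω) × L²(Ω; ℝ^N)` with `φ ∈ C_c^∞(Ω)`. -/
def testGraph {N : ℕ} (Ω : Set (Space N)) : Set (WithLp 2 (L2 Ω × L2Vec Ω)) :=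
  {w | ∃ φ : Space N → ℝ, ContDiff ℝ ∞ φ ∧ HasCompactSupport φ ∧ tsupport φ ⊆ Ω ∧
    (w.fst : Space N → ℝ) =ᵐ[volume.restrict Ω] φ ∧
    (w.snd : Space N → Space N) =ᵐ[volume.restrict Ω] fun x => gradient φ x}

/-- The Sobolev space `H_0^1(Ω)`, the closure of `C_c^∞(Ω)` in the `H^1` norm. A function `u` is
carried along with its weak gradient, as the pair `(u, ∇u)`; the norm inherited from the Hilbert
product is `(‖u‖² + ‖∇u‖²)^{1/2}`. -/
def H10 {N : ℕ} (Ω : Set (Space N)) : Submodule ℝ (WithLp 2 (L2 Ω × L2Vec Ω)) :=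
  (Submodule.span ℝ (testGraph Ω)).topologicalClosure

/-- The `L²` class of an element of `H_0^1(Ω)`. -/
def toL2 {N : ℕ} {Ω : Set (Space N)} (u : H10 Ω) : L2 Ω :=
  (u : WithLp 2 (L2 Ω × L2Vec Ω)).fst

/-- The weak gradient of an element of `H_0^1(Ω)`. -/
def weakGrad {N : ℕ} {Ω : Set (Space N)} (u : H10 Ω) : L2Vec Ω :=
  (u : WithLp 2 (L2 Ω × L2Vec Ω)).snd

/-- The eigenvalues of `-Δ` in `H_0^1(Ω)` (homogeneous Dirichlet condition), in weak form. -/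
def dirichletEigenvalues {N : ℕ} (Ω : Set (Space N)) : Set ℝ :=
  {lam | ∃ u : H10 Ω, u ≠ 0 ∧
    ∀ φ : H10 Ω, inner ℝ (weakGrad u) (weakGrad φ) = lam * inner ℝ (toL2 u) (toL2 φ)}

/-- The first Dirichlet eigenvalue `λ₁` of `-Δ`. -/
def firstEigenvalue {N : ℕ} (Ω : Set (Space N)) : ℝ :=
  sInf (dirichletEigenvalues Ω)

/-- The square of the norm of the time-dependent space `𝓗_t(Ω)`:
`‖u‖² + ε(t) ‖∇u‖²`. -/
def normSqH {N : ℕ} {Ω : Set (Space N)} (ε : ℝ → ℝ) (t : ℝ) (u : H10 Ω) : ℝ :=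
  ‖toL2 u‖ ^ 2 + ε t * ‖weakGrad u‖ ^ 2

/-- The functional `l_g(u) = ∫_Ω g u`. -/
def functionalL {N : ℕ} {Ω : Set (Space N)} (g u : L2 Ω) : ℝ :=
  ∫ x in Ω, g x * u x

/-- The pairing `(f(u), φ) = ∫_Ω f(u(x)) φ(x) dx`. -/
def pairNonlin {N : ℕ} {Ω : Set (Space N)} (f : ℝ → ℝ) (u φ : L2 Ω) : ℝ :=
  ∫ x in Ω, f (u x) * φ x

/-- `h ∈ L²_loc(ℝ; L²(Ω))`. -/
def MemL2Loc {N : ℕ} {Ω : Set (Space N)} (h : ℝ → L2 Ω) : Prop :=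
  ∀ b c : ℝ, MemLp h 2 (volume.restrict (Icc b c))

/-- `u` is continuous on `[τ, ∞)` with values in the time-dependent space: for every `t ≥ τ`,
`‖u(s) - u(t)‖_{𝓗_t} → 0` as `s → t`, `s ≥ τ`. -/
def ContinuousInH {N : ℕ} {Ω : Set (Space N)} (ε : ℝ → ℝ) (τ : ℝ) (u : ℝ → H10 Ω) : Prop :=
  ∀ t, τ ≤ t → Tendsto (fun s => normSqH ε t (u s - u t)) (𝓝[Ici τ] t) (𝓝 0)

/-- `u` satisfies, for every `φ ∈ H_0^1(Ω)` and in the sense of distributions on `(τ, ∞)`,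
`d/dt [(u, φ) + ε (∇u, ∇φ)] + (κ a(l_g(u)) - ε') (∇u, ∇φ) = κ (f(u), φ) + κ ξ (h, φ)`,
and `u ∈ C([τ, T]; 𝓗_t(Ω))` for all `T > τ`, with `u(τ) = uτ`. Only the values `u t` with
`τ ≤ t` matter. For `κ = 1` this is `u_t - ε Δu_t - a(l_g(u)) Δu = f(u) + ξ h` tested with `φ`;
for `κ = 2` it is the same identity with `a`, `f` and `h` all doubled. -/
structure IsWeakSolution {N : ℕ} {Ω : Set (Space N)} (κ : ℝ) (ε a f : ℝ → ℝ) (g : L2 Ω) (ξ : ℝ)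
    (h : ℝ → L2 Ω) (τ : ℝ) (uτ : H10 Ω) (u : ℝ → H10 Ω) : Prop where
  continuous : ContinuousInH ε τ u
  initial : u τ = uτ
  weak : ∀ φ : H10 Ω, ∀ ψ : ℝ → ℝ,
    ContDiff ℝ ∞ ψ → HasCompactSupport ψ → tsupport ψ ⊆ Ioi τ →
      -(∫ t in Ioi τ,
          (inner ℝ (toL2 (u t)) (toL2 φ) + ε t * inner ℝ (weakGrad (u t)) (weakGrad φ)) * deriv ψ t)
        + (∫ t in Ioi τ,
          (κ * a (functionalL g (toL2 (u t))) - deriv ε t)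
            * inner ℝ (weakGrad (u t)) (weakGrad φ) * ψ t)
      = ∫ t in Ioi τ,
          (κ * pairNonlin f (toL2 (u t)) (toL2 φ) + κ * ξ * inner ℝ (h t) (toL2 φ)) * ψ t

end NonlocalDiffusion

end

open NonlocalDiffusion

/-!
Write `B(t) = I - ε(t) Δ`, so that `normSqH ε t u = ⟨B(t) u, u⟩` and the weak form says that `B u`
has the distributional derivative `κ a(l_g(u)) Δu - ε' Δu + κ f(u) + κ ξ h` in the dual of
`H_0^1(Ω)`. Tested with a fixed `φ`, this integrates to an identity between any two times
(`sub_eq_integral_of_weak_deriv`). Testing with `u(t) + u(s)`, where `s < t` are close, and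
telescoping over a partition gives the energy identity
`⟨B u, u⟩' = 2 ⟨(B u)', u⟩ - ε' ‖∇u‖²` in integrated form (`energy_identity`); only the continuity of
`u` in `H_0^1(Ω)` is used. It is applied twice.

* To one solution. Since `limsup f(s)/s < ∞` and `f` is continuous, `f(s) s ≤ K (s² + 1)`, while the
  diffusion term and `ε'` have favourable signs, so that Grönwall's inequality bounds the energy on
  `[τ, T]` by the initial energy (`exists_norm_le_of_isWeakSolution`). As `ε ≥ ε(T) > 0` on `[τ, T]`,
  this is a bound in `H_0^1(Ω)`.
* To the difference `w` of two solutions, from which `h` drops out. On bounded sets of `H_0^1(Ω)` the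
  remaining force is Lipschitz into the dual (`exists_dualForce_lipschitz`): for the nonlocal
  coefficient since `a` is Lipschitz on compact sets, and for `f` by the Sobolev embedding
  `H_0^1 ⊂ L^{2*}` (`exists_sobolev`) and Hölder's inequality with exponents `N/2`, `2*`, `2*`, for
  which `p ≤ 4 / (N - 2)` is exactly what is needed. Hence `⟨B w, w⟩' ≤ C ⟨B w, w⟩`, and Grönwall's
  inequality gives the estimate (`normSqH_sub_le`).

Uniqueness is the estimate for equal initial values. The doubled normalization `κ = 2` changes
nothing, as only `κ ≥ 0` is used.
-/

open scoped ENNReal NNReal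

/-! ### Continuous functions with integrable distributional derivative -/

theorem continuous_deriv_smoothTransition : Continuous (deriv Real.smoothTransition) :=
  (Real.smoothTransition.contDiff (n := 1)).continuous_deriv le_rfl

theorem deriv_smoothTransition_eq_zero {x : ℝ} (hx : x ∉ Icc (0 : ℝ) 1) :
    deriv Real.smoothTransition x = 0 := by
  have hx' : x < 0 ∨ 1 < x := by
    by_contra! h
    exact hx ⟨h.1, h.2⟩
  rcases hx' with hx | hx
  · have : Real.smoothTransition =ᶠ[𝓝 x] fun _ => (0 : ℝ) := by
      filter_upwards [Iio_mem_nhds hx] with y hy using Real.smoothTransition.zero_of_nonpos hy.le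
    rw [this.deriv_eq, deriv_const]
  · have : Real.smoothTransition =ᶠ[𝓝 x] fun _ => (1 : ℝ) := by
      filter_upwards [Ioi_mem_nhds hx] with y hy using Real.smoothTransition.one_of_one_le hy.le
    rw [this.deriv_eq, deriv_const]

theorem integral_deriv_smoothTransition :
    ∫ y in Icc (0 : ℝ) 1, deriv Real.smoothTransition y = 1 := by
  rw [integral_Icc_eq_integral_Ioc, ← intervalIntegral.integral_of_le zero_le_one,
    intervalIntegral.integral_deriv_eq_sub
      (fun x _ => (Real.smoothTransition.contDiff (n := 1)).differentiable one_ne_zero x)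
      (continuous_deriv_smoothTransition.intervalIntegrable _ _)]
  simp

theorem hasDerivAt_smoothTransition_rescaled (s δ x : ℝ) :
    HasDerivAt (fun x => Real.smoothTransition ((x - s) / δ))
      (deriv Real.smoothTransition ((x - s) / δ) / δ) x := by
  have h1 : HasDerivAt Real.smoothTransition (deriv Real.smoothTransition ((x - s) / δ))
      ((x - s) / δ) :=
    ((Real.smoothTransition.contDiff (n := 1)).differentiable one_ne_zero _).hasDerivAt
  have h2 : HasDerivAt (fun x => (x - s) / δ) (1 / δ) x :=
    ((hasDerivAt_id x).sub_const s).div_const δ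
  exact (h1.comp x h2).congr_deriv (by rw [mul_one_div])

/-- The derivatives of the rescaled transition functions are an approximate identity at `s`. -/
theorem tendsto_integral_mul_deriv_smoothTransition {F : ℝ → ℝ} (hF : Continuous F) (s : ℝ) :
    Tendsto (fun δ => ∫ x, F x * (deriv Real.smoothTransition ((x - s) / δ) / δ))
      (𝓝[>] 0) (𝓝 (F s)) := by
  have hcont : Continuous fun δ : ℝ =>
      ∫ y in Icc (0 : ℝ) 1, F (s + δ * y) * deriv Real.smoothTransition y := by
    refine continuous_parametric_integral_of_continuous ?_ isCompact_Icc
    have := continuous_deriv_smoothTransition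
    fun_prop
  have h0 : ∫ y in Icc (0 : ℝ) 1, F (s + 0 * y) * deriv Real.smoothTransition y = F s := by
    simp only [zero_mul, add_zero]
    rw [integral_const_mul, integral_deriv_smoothTransition, mul_one]
  have hlim := (hcont.tendsto 0).mono_left (nhdsWithin_le_nhds (s := Ioi 0))
  rw [h0] at hlim
  refine hlim.congr' ?_
  filter_upwards [self_mem_nhdsWithin] with δ hδ
  have hδ : 0 < δ := hδ
  rw [setIntegral_eq_integral_of_forall_compl_eq_zero
    (fun y hy => by rw [deriv_smoothTransition_eq_zero hy, mul_zero])]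
  have h1 := Measure.integral_comp_div
    (fun y => F (s + δ * y) * deriv Real.smoothTransition y) δ
  have h2 := integral_sub_right_eq_self (μ := (volume : Measure ℝ))
    (fun x => F (s + δ * (x / δ)) * deriv Real.smoothTransition (x / δ)) s
  rw [h1, abs_of_pos hδ, smul_eq_mul] at h2
  have h3 : ∀ x, F x * (deriv Real.smoothTransition ((x - s) / δ) / δ)
      = δ⁻¹ * (F (s + δ * ((x - s) / δ)) * deriv Real.smoothTransition ((x - s) / δ)) := by
    intro x
    have : s + δ * ((x - s) / δ) = x := by field_simp; ring
    rw [this]; field_simp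
  simp_rw [h3]
  rw [integral_const_mul, h2, inv_mul_cancel_left₀ hδ.ne']

/-- The smooth cutoff which rises from `0` to `1` on `[s, s + δ]` and falls back on `[t, t + δ]`. -/
noncomputable def smoothCutoff (s t δ x : ℝ) : ℝ :=
  Real.smoothTransition ((x - s) / δ) - Real.smoothTransition ((x - t) / δ)

theorem contDiff_smoothCutoff (s t δ : ℝ) : ContDiff ℝ ∞ (smoothCutoff s t δ) := by
  have h : ContDiff ℝ ∞ Real.smoothTransition := Real.smoothTransition.contDiff (n := ⊤)
  unfold smoothCutoff
  exact (h.comp (by fun_prop)).sub (h.comp (by fun_prop))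

theorem smoothCutoff_eq_zero {s t δ x : ℝ} (hst : s ≤ t) (hδ : 0 < δ)
    (hx : x ∉ Icc s (t + δ)) : smoothCutoff s t δ x = 0 := by
  have hx' : x < s ∨ t + δ < x := by
    by_contra! h
    exact hx ⟨h.1, h.2⟩
  unfold smoothCutoff
  rcases hx' with hx | hx
  · rw [Real.smoothTransition.zero_of_nonpos, Real.smoothTransition.zero_of_nonpos, sub_zero]
    · exact div_nonpos_of_nonpos_of_nonneg (by linarith) hδ.le
    · exact div_nonpos_of_nonpos_of_nonneg (by linarith) hδ.le
  · rw [Real.smoothTransition.one_of_one_le, Real.smoothTransition.one_of_one_le, sub_self]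
    · rw [one_le_div hδ]; linarith
    · rw [one_le_div hδ]; linarith

theorem tsupport_smoothCutoff {s t δ : ℝ} (hst : s ≤ t) (hδ : 0 < δ) :
    tsupport (smoothCutoff s t δ) ⊆ Icc s (t + δ) :=
  closure_minimal (fun _ hx => by_contra fun h => hx (smoothCutoff_eq_zero hst hδ h)) isClosed_Icc

theorem abs_smoothCutoff_le_one (s t δ x : ℝ) : |smoothCutoff s t δ x| ≤ 1 := by
  unfold smoothCutoff
  have h1 := Real.smoothTransition.nonneg ((x - s) / δ)
  have h2 := Real.smoothTransition.nonneg ((x - t) / δ)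
  have h3 := Real.smoothTransition.le_one ((x - s) / δ)
  have h4 := Real.smoothTransition.le_one ((x - t) / δ)
  rw [abs_le]; constructor <;> linarith

theorem deriv_smoothCutoff (s t δ x : ℝ) : deriv (smoothCutoff s t δ) x =
    deriv Real.smoothTransition ((x - s) / δ) / δ
      - deriv Real.smoothTransition ((x - t) / δ) / δ :=
  ((hasDerivAt_smoothTransition_rescaled s δ x).sub
    (hasDerivAt_smoothTransition_rescaled t δ x)).deriv

theorem tendsto_smoothTransition_rescaled (s x : ℝ) :
    Tendsto (fun δ => Real.smoothTransition ((x - s) / δ)) (𝓝[>] 0)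
      (𝓝 ((Ioi s).indicator 1 x)) := by
  refine tendsto_const_nhds.congr' ?_
  by_cases hx : s < x
  · have h : Iio (x - s) ∈ 𝓝 (0 : ℝ) := Iio_mem_nhds (by linarith)
    filter_upwards [self_mem_nhdsWithin, nhdsWithin_le_nhds h] with δ hδ hδ'
    rw [indicator_of_mem (by exact hx), Real.smoothTransition.one_of_one_le, Pi.one_apply]
    rw [one_le_div hδ]; exact (mem_Iio.1 hδ').le
  · filter_upwards [self_mem_nhdsWithin] with δ hδ
    rw [indicator_of_notMem (by exact hx), Real.smoothTransition.zero_of_nonpos]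
    exact div_nonpos_of_nonpos_of_nonneg (by linarith) (le_of_lt hδ)

theorem tendsto_smoothCutoff {s t : ℝ} (hst : s ≤ t) (x : ℝ) :
    Tendsto (fun δ => smoothCutoff s t δ x) (𝓝[>] 0) (𝓝 ((Ioc s t).indicator 1 x)) := by
  have h := (tendsto_smoothTransition_rescaled s x).sub (tendsto_smoothTransition_rescaled t x)
  have hx : (Ioc s t).indicator (1 : ℝ → ℝ) x = (Ioi s).indicator 1 x - (Ioi t).indicator 1 x := by
    rw [← Ioi_sdiff_Ioi, indicator_sdiff (Ioi_subset_Ioi hst)]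
    rfl
  rw [hx]
  exact h

/-- A continuous function with locally integrable distributional derivative `G` on `(τ, ∞)` is a
primitive of `G` on `[τ, ∞)`. -/
theorem sub_eq_integral_of_weak_deriv {F G : ℝ → ℝ} {τ : ℝ} (hF : ContinuousOn F (Ici τ))
    (hG : ∀ T, IntegrableOn G (Icc τ T))
    (hFG : ∀ ψ : ℝ → ℝ, ContDiff ℝ ∞ ψ → HasCompactSupport ψ → tsupport ψ ⊆ Ioi τ →
      -(∫ t in Ioi τ, F t * deriv ψ t) = ∫ t in Ioi τ, G t * ψ t)
    {s t : ℝ} (hs : τ ≤ s) (hst : s ≤ t) :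
    F t - F s = ∫ r in s..t, G r := by
  have hGi : ∀ a b, τ ≤ a → τ ≤ b → IntervalIntegrable G volume a b := fun a b ha hb => by
    rw [intervalIntegrable_iff']
    refine (hG (max a b)).mono_set fun x hx => ?_
    exact ⟨(le_min ha hb).trans hx.1, hx.2⟩
  -- first away from the left endpoint, where the cutoffs are admissible test functions
  have key : ∀ s, τ < s → s ≤ t → F t - F s = ∫ r in s..t, G r := by
    intro s hs hst
    -- `F` extended to a continuous function on the line
    set F' : ℝ → ℝ := fun x => F (max τ x) with hF'
    have hF'c : Continuous F' :=
      hF.comp_continuous (by fun_prop) fun x => mem_Ici.2 (le_max_left _ _)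
    have hFF' : ∀ x, τ ≤ x → F' x = F x := fun x hx => by simp [hF', max_eq_right hx]
    have hL : Tendsto (fun δ => ∫ x in Ioi τ, F x * deriv (smoothCutoff s t δ) x) (𝓝[>] 0)
        (𝓝 (F s - F t)) := by
      have h := (tendsto_integral_mul_deriv_smoothTransition hF'c s).sub
        (tendsto_integral_mul_deriv_smoothTransition hF'c t)
      rw [hFF' s hs.le, hFF' t (hs.le.trans hst)] at h
      refine h.congr' ?_
      filter_upwards [self_mem_nhdsWithin] with δ hδ
      have hδ : 0 < δ := hδ
      have hint : ∀ s, Integrable fun x =>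
          F' x * (deriv Real.smoothTransition ((x - s) / δ) / δ) := by
        intro s
        refine Continuous.integrable_of_hasCompactSupport ?_ ?_
        · have := continuous_deriv_smoothTransition
          fun_prop
        · refine HasCompactSupport.intro (isCompact_Icc (a := s) (b := s + δ)) fun x hx => ?_
          rw [deriv_smoothTransition_eq_zero, zero_div, mul_zero]
          contrapose! hx
          have h1 := (le_div_iff₀ hδ).1 hx.1
          have h2 := (div_le_iff₀ hδ).1 hx.2
          constructor <;> linarith
      rw [← integral_sub (hint s) (hint t), ← setIntegral_eq_integral_of_forall_compl_eq_zero
        (s := Ioi τ)]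
      · refine setIntegral_congr_fun measurableSet_Ioi fun x hx => ?_
        simp only [deriv_smoothCutoff]
        rw [hFF' x (le_of_lt hx)]; ring
      · intro x hx
        have hx : x ≤ τ := not_lt.1 hx
        rw [deriv_smoothTransition_eq_zero, deriv_smoothTransition_eq_zero]
        · simp
        · intro h
          have := (le_div_iff₀ hδ).1 h.1
          linarith
        · intro h
          have := (le_div_iff₀ hδ).1 h.1
          linarith
    have hR : Tendsto (fun δ => ∫ x in Ioi τ, G x * smoothCutoff s t δ x) (𝓝[>] 0)
        (𝓝 (∫ x in Ioi τ, G x * (Ioc s t).indicator 1 x)) := by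
      have hind : Integrable ((Icc τ (t + 1)).indicator G) :=
        (hG (t + 1)).integrable_indicator measurableSet_Icc
      have hmeas : AEStronglyMeasurable G (volume.restrict (Ioi τ)) := by
        have : Ioi τ ⊆ ⋃ n : ℕ, Icc τ (n : ℝ) := fun x hx => by
          obtain ⟨n, hn⟩ := exists_nat_ge x
          exact mem_iUnion.2 ⟨n, le_of_lt hx, hn⟩
        refine AEStronglyMeasurable.mono_set this ?_
        exact AEStronglyMeasurable.iUnion fun n => (hG n).aestronglyMeasurable
      refine tendsto_integral_filter_of_dominated_convergence
        (fun x => ‖(Icc τ (t + 1)).indicator G x‖) ?_ ?_ hind.norm.integrableOn ?_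
      · refine Eventually.of_forall fun δ => hmeas.mul ?_
        exact (contDiff_smoothCutoff s t δ).continuous.aestronglyMeasurable
      · filter_upwards [self_mem_nhdsWithin, nhdsWithin_le_nhds (Iio_mem_nhds zero_lt_one)]
          with δ hδ hδ1
        refine Eventually.of_forall fun x => ?_
        by_cases hx : x ∈ Icc τ (t + 1)
        · rw [indicator_of_mem hx, norm_mul]
          exact mul_le_of_le_one_right (norm_nonneg _) (abs_smoothCutoff_le_one _ _ _ _)
        · rw [smoothCutoff_eq_zero hst hδ, mul_zero, norm_zero]
          · exact norm_nonneg _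
          · exact fun h => hx ⟨hs.le.trans h.1, h.2.trans (by have := mem_Iio.1 hδ1; linarith)⟩
      · exact Eventually.of_forall fun x => (tendsto_smoothCutoff hst x).const_mul _
    have hRe : ∫ x in Ioi τ, G x * (Ioc s t).indicator 1 x = ∫ r in s..t, G r := by
      rw [intervalIntegral.integral_of_le hst]
      have : (fun x => G x * (Ioc s t).indicator 1 x) = (Ioc s t).indicator G := by
        ext x
        by_cases hx : x ∈ Ioc s t <;> simp [hx]
      rw [this, setIntegral_indicator measurableSet_Ioc, inter_eq_right.2]
      exact fun x hx => hs.trans hx.1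
    rw [hRe] at hR
    have := tendsto_nhds_unique hR (hL.neg.congr' ?_)
    · linarith
    · filter_upwards [self_mem_nhdsWithin] with δ hδ
      refine hFG _ (contDiff_smoothCutoff s t δ) ?_ ?_
      · exact HasCompactSupport.of_support_subset_isCompact isCompact_Icc
          ((subset_tsupport _).trans (tsupport_smoothCutoff hst hδ))
      · exact (tsupport_smoothCutoff hst hδ).trans fun x hx => hs.trans_le hx.1
  rcases hst.eq_or_lt with rfl | hst'
  · simp
  rcases hs.eq_or_lt with rfl | hs'
  · have h1 : Tendsto (fun s => F t - F s) (𝓝[>] τ) (𝓝 (F t - F τ)) :=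
      tendsto_const_nhds.sub ((hF τ self_mem_Ici).mono_left (nhdsWithin_mono _ Ioi_subset_Ici_self))
    have h2 : Tendsto (fun s => ∫ r in s..t, G r) (𝓝[>] τ) (𝓝 (∫ r in τ..t, G r)) := by
      have hc := intervalIntegral.continuousOn_primitive_interval_left (f := G) (μ := volume)
        (a := τ) (b := t) (by rw [uIcc_of_le hst]; exact hG t)
      rw [uIcc_of_le hst] at hc
      refine (hc τ (left_mem_Icc.2 hst)).mono_left ?_
      rw [nhdsWithin_Icc_eq_nhdsGE hst']
      exact nhdsWithin_mono _ Ioi_subset_Ici_self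
    refine tendsto_nhds_unique h1 (h2.congr' ?_)
    filter_upwards [self_mem_nhdsWithin, nhdsWithin_le_nhds (Iio_mem_nhds hst')] with s hs hs'
    exact (key s hs (le_of_lt hs')).symm
  · exact key s hs' hst

/-! ### Grönwall's inequality and the energy identity -/

/-- Grönwall's inequality in integral form. -/
theorem le_mul_exp_of_le_integral {y : ℝ → ℝ} {a b C D : ℝ} (hC : 0 ≤ C)
    (hy : ContinuousOn y (Icc a b)) (h : ∀ t ∈ Icc a b, y t ≤ D + C * ∫ r in a..t, y r) :
    ∀ t ∈ Icc a b, y t ≤ D * Real.exp (C * (t - a)) := by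
  intro t ht
  have hab : a ≤ b := ht.1.trans ht.2
  -- a continuous extension of `y` to the line, so that its primitive is differentiable everywhere
  set y' : ℝ → ℝ := IccExtend hab ((Icc a b).domRestrict y) with hy'
  have hy'c : Continuous y' := hy.domRestrict.Icc_extend'
  have hyy' : ∀ x ∈ Icc a b, y' x = y x := fun x hx => IccExtend_of_mem hab _ hx
  have hint : ∀ x ∈ Icc a b, ∫ r in a..x, y' r = ∫ r in a..x, y r := fun x hx => by
    refine intervalIntegral.integral_congr fun r hr => hyy' r ?_
    rw [uIcc_of_le hx.1] at hr
    exact ⟨hr.1, hr.2.trans hx.2⟩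
  set z : ℝ → ℝ := fun x => D + C * ∫ r in a..x, y' r with hz
  have hzd : ∀ x, HasDerivAt z (C * y' x) x := fun x =>
    ((intervalIntegral.integral_hasDerivAt_right (hy'c.intervalIntegrable _ _)
      (hy'c.stronglyMeasurableAtFilter _ _) hy'c.continuousAt).const_mul C).const_add D
  have hyz : ∀ x ∈ Icc a b, y x ≤ z x := fun x hx => by
    simp only [hz, hint x hx]
    exact h x hx
  have := le_gronwallBound_of_liminf_deriv_right_le (f := z) (f' := fun x => C * y' x) (δ := D)
    (K := C) (ε := 0) (a := a) (b := b) (fun x _ => (hzd x).continuousAt.continuousWithinAt)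
    (fun x _ r hr => (hzd x).hasDerivWithinAt.liminf_right_slope_le hr) (by simp [hz])
    (fun x hx => by
      rw [add_zero, hyy' x (Ico_subset_Icc_self hx)]
      exact mul_le_mul_of_nonneg_left (hyz x (Ico_subset_Icc_self hx)) hC) t ht
  rw [gronwallBound_ε0] at this
  exact (hyz t ht).trans this

/-- A function whose increments over short intervals are arbitrarily small multiples of those of a
fixed function has the same values at both ends. -/
theorem eq_of_abs_sub_le_mul_sub {Y K : ℝ → ℝ} {a b : ℝ} (hab : a ≤ b)
    (h : ∀ η > 0, ∃ δ > 0, ∀ s t, a ≤ s → s ≤ t → t ≤ b → t - s < δ →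
      |Y t - Y s| ≤ η * (K t - K s)) : Y b = Y a := by
  have key : ∀ η > 0, |Y b - Y a| ≤ η * (K b - K a) := by
    intro η hη
    obtain ⟨δ, hδ, h⟩ := h η hη
    obtain ⟨n, hn⟩ := exists_nat_gt ((b - a) / δ)
    have hn0 : (0 : ℝ) < n := lt_of_le_of_lt (div_nonneg (by linarith) hδ.le) hn
    set x : ℕ → ℝ := fun i => a + i * ((b - a) / n) with hx
    have hstep : 0 ≤ (b - a) / n := div_nonneg (by linarith) hn0.le
    have hlt : (b - a) / n < δ := by
      rw [div_lt_iff₀ hδ] at hn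
      rw [div_lt_iff₀ hn0]; linarith
    have hxn : x n = b := by simp only [hx]; field_simp; ring
    have hx0 : x 0 = a := by simp [hx]
    have hxs : ∀ i, x (i + 1) = x i + (b - a) / n := fun i => by
      simp only [hx]; push_cast; ring
    have hmono : Monotone x := monotone_nat_of_le_succ fun i => by rw [hxs]; linarith
    have ind : ∀ i ≤ n, |Y (x i) - Y a| ≤ η * (K (x i) - K a) := by
      intro i
      induction i with
      | zero => intro _; simp [hx0]
      | succ i ih =>
        intro hi
        have h1 := ih (by omega)
        have h2 := h (x i) (x (i + 1)) (hx0 ▸ hmono (Nat.zero_le i)) (hmono (Nat.le_succ i))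
          (hxn ▸ hmono hi) (by rw [hxs]; linarith)
        calc |Y (x (i + 1)) - Y a| ≤ |Y (x (i + 1)) - Y (x i)| + |Y (x i) - Y a| :=
              abs_sub_le _ _ _
          _ ≤ _ := by linarith
    simpa [hxn] using ind n le_rfl
  by_contra hne
  have hpos : 0 < |Y b - Y a| := abs_pos.2 (sub_ne_zero.2 hne)
  have hK : 0 ≤ |K b - K a| := abs_nonneg _
  have h1 := key (|Y b - Y a| / (2 * (|K b - K a| + 1))) (by positivity)
  have h2 : |Y b - Y a| / (2 * (|K b - K a| + 1)) * (K b - K a) ≤ |Y b - Y a| / 2 := by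
    rw [div_mul_eq_mul_div, div_le_div_iff₀ (by positivity) two_pos]
    nlinarith [le_abs_self (K b - K a)]
  linarith

/-- The energy identity. If `B(t) = P* P + ε(t) Q* Q` and `B w` is a primitive of `A + P* h`, with
`A` continuous into the dual of `V` and `h` integrable, tested against every fixed element of `V`,
then `d/dt ⟨B w, w⟩ = 2 ⟨A + P* h, w⟩ - ε' ‖Q w‖²` in integrated form. No differentiability of `w`
is needed: testing with `w t + w s` shows that the increments of both sides over short intervals agree
up to the modulus of continuity of `w`. -/
theorem energy_identity {V X Y : Type*} [NormedAddCommGroup V] [NormedSpace ℝ V]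
    [NormedAddCommGroup X] [InnerProductSpace ℝ X] [NormedAddCommGroup Y] [InnerProductSpace ℝ Y]
    (P : V →L[ℝ] X) (Q : V →L[ℝ] Y) {ε : ℝ → ℝ} (hε : ContDiff ℝ 1 ε) {w : ℝ → V} {a b : ℝ}
    (hab : a ≤ b) (hw : ContinuousOn w (Icc a b)) {A : ℝ → V →L[ℝ] ℝ}
    (hA : ContinuousOn A (Icc a b)) {h : ℝ → X} (hh : IntegrableOn h (Icc a b))
    (hwA : ∀ φ : V, ∀ s t, a ≤ s → s ≤ t → t ≤ b →
      (inner ℝ (P (w t)) (P φ) + ε t * inner ℝ (Q (w t)) (Q φ))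
        - (inner ℝ (P (w s)) (P φ) + ε s * inner ℝ (Q (w s)) (Q φ))
        = ∫ r in s..t, (A r φ + inner ℝ (h r) (P φ))) :
    IntegrableOn (fun r => 2 * (A r (w r) + inner ℝ (h r) (P (w r)))
      - deriv ε r * ‖Q (w r)‖ ^ 2) (Icc a b) ∧
    (‖P (w b)‖ ^ 2 + ε b * ‖Q (w b)‖ ^ 2) - (‖P (w a)‖ ^ 2 + ε a * ‖Q (w a)‖ ^ 2)
      = ∫ r in a..b, (2 * (A r (w r) + inner ℝ (h r) (P (w r)))
        - deriv ε r * ‖Q (w r)‖ ^ 2) := by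
  obtain ⟨G, hGdef⟩ : ∃ G : ℝ → V →L[ℝ] ℝ, G = fun r => A r + (innerSL ℝ (h r)).comp P := ⟨_, rfl⟩
  have hGapp : ∀ r φ, A r φ + inner ℝ (h r) (P φ) = G r φ := fun r φ => by rw [hGdef]; rfl
  have hG : IntegrableOn G (Icc a b) := by
    rw [hGdef]
    exact (hA.integrableOn_compact isCompact_Icc).add
      (((ContinuousLinearMap.compL ℝ V X ℝ).flip P).integrable_comp
        ((innerSL ℝ).integrable_comp hh))
  simp only [hGapp] at hwA ⊢
  have hεc : Continuous (deriv ε) := hε.continuous_deriv le_rfl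
  have hGw : IntegrableOn (fun r => G r (w r)) (Icc a b) := by
    obtain ⟨C, hC⟩ := isCompact_Icc.exists_bound_of_continuousOn hw
    refine Integrable.mono' (hG.norm.mul_const C) ?_ ?_
    · exact (ContinuousLinearMap.apply ℝ ℝ).aestronglyMeasurable_comp₂
        (hw.aestronglyMeasurable measurableSet_Icc) hG.aestronglyMeasurable
    · filter_upwards [ae_restrict_mem measurableSet_Icc] with r hr
      exact (G r).le_opNorm_of_le (hC r hr)
  have hQw : ContinuousOn (fun r => deriv ε r * ‖Q (w r)‖ ^ 2) (Icc a b) :=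
    hεc.continuousOn.mul ((Q.continuous.comp_continuousOn hw).norm.pow 2)
  have hE : IntegrableOn (fun r => 2 * G r (w r) - deriv ε r * ‖Q (w r)‖ ^ 2) (Icc a b) :=
    (hGw.const_mul 2).sub (hQw.integrableOn_compact isCompact_Icc)
  have hK : IntegrableOn (fun r => 2 * ‖G r‖ + |deriv ε r|) (Icc a b) :=
    (hG.norm.const_mul 2).add (hεc.abs.continuousOn.integrableOn_compact isCompact_Icc)
  have hii : ∀ {s t : ℝ} {g : ℝ → ℝ}, IntegrableOn g (Icc a b) → a ≤ s → s ≤ t → t ≤ b →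
      IntervalIntegrable g volume s t := fun hg hs hst ht => by
    rw [intervalIntegrable_iff_integrableOn_Icc_of_le hst]
    exact hg.mono_set (Icc_subset_Icc hs ht)
  set y : ℝ → ℝ := fun t => ‖P (w t)‖ ^ 2 + ε t * ‖Q (w t)‖ ^ 2 with hy
  have hmain : (y b - ∫ r in a..b, (2 * G r (w r) - deriv ε r * ‖Q (w r)‖ ^ 2))
      = y a - ∫ r in a..a, (2 * G r (w r) - deriv ε r * ‖Q (w r)‖ ^ 2) := by
    refine eq_of_abs_sub_le_mul_sub
      (Y := fun t => y t - ∫ r in a..t, (2 * G r (w r) - deriv ε r * ‖Q (w r)‖ ^ 2))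
      (K := fun t => ∫ r in a..t, (2 * ‖G r‖ + |deriv ε r|)) hab ?_
    intro η hη
    obtain ⟨δ₁, hδ₁, h₁⟩ := Metric.uniformContinuousOn_iff.1
      (isCompact_Icc.uniformContinuousOn_of_continuous hw) η hη
    have hq : ContinuousOn (fun z : ℝ × ℝ => inner ℝ (Q (w z.1)) (Q (w z.2)))
        (Icc a b ×ˢ Icc a b) := by
      refine ContinuousOn.inner ?_ ?_
      · exact Q.continuous.comp_continuousOn (hw.comp continuousOn_fst fun z hz => hz.1)
      · exact Q.continuous.comp_continuousOn (hw.comp continuousOn_snd fun z hz => hz.2)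
    obtain ⟨δ₂, hδ₂, h₂⟩ := Metric.uniformContinuousOn_iff.1
      ((isCompact_Icc.prod isCompact_Icc).uniformContinuousOn_of_continuous hq) η hη
    refine ⟨min δ₁ δ₂, lt_min hδ₁ hδ₂, fun s t hs hst ht hd => ?_⟩
    have hsm : s ∈ Icc a b := ⟨hs, hst.trans ht⟩
    have htm : t ∈ Icc a b := ⟨hs.trans hst, ht⟩
    have hprim : ∀ {g : ℝ → ℝ}, IntegrableOn g (Icc a b) →
        (∫ r in a..t, g r) - ∫ r in a..s, g r = ∫ r in s..t, g r := fun hg => by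
      rw [← intervalIntegral.integral_add_adjacent_intervals (hii hg le_rfl hs (hst.trans ht))
        (hii hg hs hst ht), add_sub_cancel_left]
    have hGφ : ∀ φ : V, IntegrableOn (fun r => G r φ) (Icc a b) := fun φ =>
      hG.apply_continuousLinearMap φ
    have hdε : ε t - ε s = ∫ r in s..t, deriv ε r :=
      (intervalIntegral.integral_deriv_eq_sub
        (fun x _ => (hε.differentiable one_ne_zero) x) (hεc.intervalIntegrable _ _)).symm
    -- the increment of the energy, from the equation tested with `w t + w s`
    have hinc : y t - y s = (∫ r in s..t, G r (w t + w s))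
        - ∫ r in s..t, deriv ε r * inner ℝ (Q (w s)) (Q (w t)) := by
      rw [← hwA (w t + w s) s t hs hst ht, intervalIntegral.integral_mul_const, ← hdε]
      simp only [hy, map_add, inner_add_right, real_inner_self_eq_norm_sq]
      rw [real_inner_comm (P (w s)) (P (w t)), real_inner_comm (Q (w s)) (Q (w t))]
      ring
    have hcq : IntegrableOn (fun r => deriv ε r * inner ℝ (Q (w s)) (Q (w t))) (Icc a b) :=
      (hεc.mul continuous_const).continuousOn.integrableOn_compact isCompact_Icc
    have hdiff : (y t - ∫ r in a..t, (2 * G r (w r) - deriv ε r * ‖Q (w r)‖ ^ 2))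
        - (y s - ∫ r in a..s, (2 * G r (w r) - deriv ε r * ‖Q (w r)‖ ^ 2))
        = ∫ r in s..t, ((G r (w t + w s) - deriv ε r * inner ℝ (Q (w s)) (Q (w t)))
          - (2 * G r (w r) - deriv ε r * ‖Q (w r)‖ ^ 2)) := by
      rw [intervalIntegral.integral_sub
        ((hii (hGφ _) hs hst ht).sub (hii hcq hs hst ht)) (hii hE hs hst ht),
        intervalIntegral.integral_sub (hii (hGφ _) hs hst ht) (hii hcq hs hst ht), ← hprim hE]
      linarith
    rw [hdiff, hprim hK, ← intervalIntegral.integral_const_mul, ← Real.norm_eq_abs]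
    refine intervalIntegral.norm_integral_le_of_norm_le hst ?_ ((hii hK hs hst ht).const_mul η)
    refine Eventually.of_forall fun r hr => ?_
    have hrm : r ∈ Icc a b := ⟨hs.trans hr.1.le, hr.2.trans ht⟩
    have hd1 : ∀ u v : ℝ, s ≤ u → u ≤ t → s ≤ v → v ≤ t → dist u v < min δ₁ δ₂ :=
      fun u v h1 h2 h3 h4 => by
        rw [Real.dist_eq, abs_lt]; constructor <;> linarith
    have e1 : ‖w t - w r‖ < η := by
      rw [← dist_eq_norm]
      exact h₁ t htm r hrm ((hd1 t r hst le_rfl hr.1.le hr.2).trans_le (min_le_left _ _))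
    have e2 : ‖w s - w r‖ < η := by
      rw [← dist_eq_norm]
      exact h₁ s hsm r hrm ((hd1 s r le_rfl hst hr.1.le hr.2).trans_le (min_le_left _ _))
    have e3 : |inner ℝ (Q (w s)) (Q (w t)) - ‖Q (w r)‖ ^ 2| < η := by
      rw [← real_inner_self_eq_norm_sq, ← Real.dist_eq]
      refine h₂ (s, t) ⟨hsm, htm⟩ (r, r) ⟨hrm, hrm⟩ ?_
      rw [Prod.dist_eq]
      exact max_lt ((hd1 s r le_rfl hst hr.1.le hr.2).trans_le (min_le_right _ _))
        ((hd1 t r hst le_rfl hr.1.le hr.2).trans_le (min_le_right _ _))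
    have e4 : (G r (w t + w s) - deriv ε r * inner ℝ (Q (w s)) (Q (w t)))
          - (2 * G r (w r) - deriv ε r * ‖Q (w r)‖ ^ 2)
        = G r (w t - w r) + G r (w s - w r)
          - deriv ε r * (inner ℝ (Q (w s)) (Q (w t)) - ‖Q (w r)‖ ^ 2) := by
      simp only [map_add, map_sub]; ring
    rw [e4]
    have f1 := (G r).le_opNorm_of_le e1.le
    have f2 := (G r).le_opNorm_of_le e2.le
    have f3 : ‖deriv ε r * (inner ℝ (Q (w s)) (Q (w t)) - ‖Q (w r)‖ ^ 2)‖ ≤ |deriv ε r| * η := by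
      rw [norm_mul]
      exact mul_le_mul_of_nonneg_left e3.le (norm_nonneg _)
    have f4 := norm_sub_le (G r (w t - w r) + G r (w s - w r))
      (deriv ε r * (inner ℝ (Q (w s)) (Q (w t)) - ‖Q (w r)‖ ^ 2))
    have f5 := norm_add_le (G r (w t - w r)) (G r (w s - w r))
    linarith
  simp only [intervalIntegral.integral_same, sub_zero] at hmain
  simp only [hy] at hmain
  refine ⟨hE, ?_⟩
  linarith

/-! ### The Sobolev embedding of `H_0^1(Ω)` -/

/-- `toL2` as a continuous linear map. -/
noncomputable def toL2L {N : ℕ} (Ω : Set (Space N)) : H10 Ω →L[ℝ] L2 Ω :=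
  (WithLp.fstL 2 ℝ (L2 Ω) (L2Vec Ω)).comp (H10 Ω).subtypeL

/-- `weakGrad` as a continuous linear map. -/
noncomputable def weakGradL {N : ℕ} (Ω : Set (Space N)) : H10 Ω →L[ℝ] L2Vec Ω :=
  (WithLp.sndL 2 ℝ (L2 Ω) (L2Vec Ω)).comp (H10 Ω).subtypeL

theorem toL2L_apply {N : ℕ} {Ω : Set (Space N)} (u : H10 Ω) : toL2L Ω u = toL2 u := rfl

theorem weakGradL_apply {N : ℕ} {Ω : Set (Space N)} (u : H10 Ω) : weakGradL Ω u = weakGrad u := rfl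

theorem H10_norm_sq {N : ℕ} {Ω : Set (Space N)} (u : H10 Ω) :
    ‖u‖ ^ 2 = ‖toL2 u‖ ^ 2 + ‖weakGrad u‖ ^ 2 :=
  WithLp.prod_norm_sq_eq_of_L2 (u : WithLp 2 (L2 Ω × L2Vec Ω))

theorem norm_toL2_le {N : ℕ} {Ω : Set (Space N)} (u : H10 Ω) : ‖toL2 u‖ ≤ ‖u‖ :=
  WithLp.norm_fst_le _ (u : WithLp 2 (L2 Ω × L2Vec Ω))

theorem norm_weakGrad_le {N : ℕ} {Ω : Set (Space N)} (u : H10 Ω) : ‖weakGrad u‖ ≤ ‖u‖ :=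
  WithLp.norm_snd_le _ (u : WithLp 2 (L2 Ω × L2Vec Ω))

/-- The critical Sobolev exponent `2* = 2N / (N - 2)`. -/
noncomputable def sobolevExponent (N : ℕ) : ℝ≥0 := Real.toNNReal (2 * N / (N - 2))

theorem coe_sobolevExponent {N : ℕ} (hN : 3 ≤ N) :
    (sobolevExponent N : ℝ) = 2 * N / (N - 2) := by
  have : (3 : ℝ) ≤ N := by exact_mod_cast hN
  exact Real.coe_toNNReal _ (div_nonneg (by positivity) (by linarith))

theorem mem_testGraph_of_mem_span {N : ℕ} {Ω : Set (Space N)} {w : WithLp 2 (L2 Ω × L2Vec Ω)}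
    (hw : w ∈ Submodule.span ℝ (testGraph Ω)) : w ∈ testGraph Ω := by
  induction hw using Submodule.span_induction with
  | mem w hw => exact hw
  | zero =>
    refine ⟨fun _ => 0, contDiff_const, HasCompactSupport.zero, ?_, ?_, ?_⟩
    · simp [tsupport]
    · exact Lp.coeFn_zero ..
    · simp only [gradient_fun_const]
      exact Lp.coeFn_zero ..
  | add v w _ _ hv hw =>
    obtain ⟨φ, h1, h2, h3, h4, h5⟩ := hv
    obtain ⟨χ, k1, k2, k3, k4, k5⟩ := hw
    refine ⟨φ + χ, h1.add k1, h2.add k2, ?_, ?_, ?_⟩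
    · exact (tsupport_add φ χ).trans (union_subset h3 k3)
    · filter_upwards [Lp.coeFn_add v.fst w.fst, h4, k4] with x a b c
      rw [WithLp.add_fst, a, Pi.add_apply, Pi.add_apply, b, c]
    · filter_upwards [Lp.coeFn_add v.snd w.snd, h5, k5] with x a b c
      rw [WithLp.add_snd, a, Pi.add_apply, b, c]
      simp only [gradient]
      rw [fderiv_add (h1.differentiable (by simp) x) (k1.differentiable (by simp) x), map_add]
  | smul r w _ hw =>
    obtain ⟨χ, k1, k2, k3, k4, k5⟩ := hw
    refine ⟨r • χ, k1.const_smul r, k2.smul_left (f := fun _ => r), ?_, ?_, ?_⟩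
    · exact (tsupport_smul_subset_right (fun _ => r) χ).trans k3
    · filter_upwards [Lp.coeFn_smul r w.fst, k4] with x a b
      rw [WithLp.smul_fst, a, Pi.smul_apply, Pi.smul_apply, b]
    · filter_upwards [Lp.coeFn_smul r w.snd, k5] with x a b
      rw [WithLp.smul_snd, a, Pi.smul_apply, b]
      simp only [gradient]
      rw [fderiv_const_smul (k1.differentiable (by simp) x), map_smulₛₗ]
      rfl

/-- The Sobolev inequality for smooth functions with compact support in `Ω`. -/
theorem exists_sobolev_testGraph {N : ℕ} (hN : 3 ≤ N) (Ω : Set (Space N)) :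
    ∃ S : ℝ≥0, ∀ w ∈ testGraph Ω,
      eLpNorm w.fst (sobolevExponent N) (volume.restrict Ω) ≤ S * ‖w.snd‖ₑ := by
  have hN' : (3 : ℝ) ≤ N := by exact_mod_cast hN
  refine ⟨SNormLESNormFDerivOfEqConst ℝ (volume : Measure (Space N)) 2, fun w hw => ?_⟩
  obtain ⟨φ, h1, h2, h3, h4, h5⟩ := hw
  have h1' : ContDiff ℝ 1 φ := h1.of_le (by simp)
  have hgn : ∀ x, ‖gradient φ x‖ = ‖fderiv ℝ φ x‖ := fun x => by
    simp [gradient]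
  calc eLpNorm w.fst (sobolevExponent N) (volume.restrict Ω)
      = eLpNorm φ (sobolevExponent N) (volume.restrict Ω) := eLpNorm_congr_ae h4
    _ ≤ eLpNorm φ (sobolevExponent N) volume := eLpNorm_mono_measure _ Measure.restrict_le_self
    _ ≤ SNormLESNormFDerivOfEqConst ℝ (volume : Measure (Space N)) 2
        * eLpNorm (fderiv ℝ φ) (2 : ℝ≥0) volume := by
      refine eLpNorm_le_eLpNorm_fderiv_of_eq volume (p := 2) h1' h2 (by norm_num)
        (by simp; omega) ?_
      rw [coe_sobolevExponent hN, finrank_euclideanSpace_fin]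
      have : (N : ℝ) - 2 ≠ 0 := by linarith
      push_cast
      field_simp
    _ = SNormLESNormFDerivOfEqConst ℝ (volume : Measure (Space N)) 2 * ‖w.snd‖ₑ := by
      congr 1
      rw [Lp.enorm_def, eLpNorm_congr_ae h5, ENNReal.coe_ofNat,
        eLpNorm_restrict_eq_of_support_subset]
      · exact (eLpNorm_congr_norm_ae (Eventually.of_forall hgn)).symm
      · intro x hx
        refine h3 (support_fderiv_subset ℝ ?_)
        rw [Function.mem_support] at hx ⊢
        rwa [← norm_ne_zero_iff, ← hgn, norm_ne_zero_iff]

/-- The Sobolev embedding `H_0^1(Ω) ⊂ L^{2*}(Ω)`: it passes from the test functions to their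
closure by Fatou's lemma. -/
theorem exists_sobolev {N : ℕ} (hN : 3 ≤ N) (Ω : Set (Space N)) :
    ∃ S : ℝ≥0, ∀ u : H10 Ω,
      eLpNorm (toL2 u) (sobolevExponent N) (volume.restrict Ω) ≤ S * ‖u‖ₑ := by
  obtain ⟨S, hS⟩ := exists_sobolev_testGraph hN Ω
  refine ⟨S, fun u => ?_⟩
  have hu : (u : WithLp 2 (L2 Ω × L2Vec Ω)) ∈
      closure (Submodule.span ℝ (testGraph Ω) : Set (WithLp 2 (L2 Ω × L2Vec Ω))) := u.2
  obtain ⟨w, hw, hlim⟩ := mem_closure_iff_seq_limit.1 hu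
  have hfst : Tendsto (fun n => (w n).fst) atTop (𝓝 (toL2 u)) :=
    ((WithLp.fstL 2 ℝ (L2 Ω) (L2Vec Ω)).continuous.tendsto _).comp hlim
  have hsnd : Tendsto (fun n => (S : ℝ≥0∞) * ‖(w n).snd‖ₑ) atTop (𝓝 (S * ‖weakGrad u‖ₑ)) :=
    ENNReal.Tendsto.const_mul (((WithLp.sndL 2 ℝ (L2 Ω) (L2Vec Ω)).continuous.tendsto _).comp
      hlim).enorm (Or.inr ENNReal.coe_ne_top)
  have hle : (S : ℝ≥0∞) * ‖weakGrad u‖ₑ ≤ S * ‖u‖ₑ := by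
    gcongr
    exact enorm_le_iff_norm_le.2 (norm_weakGrad_le u)
  refine le_trans (le_of_forall_gt_imp_ge_of_dense fun C hC => ?_) hle
  refine eLpNorm_le_of_tendstoInMeasure (f := fun n => ((w n).fst : Space N → ℝ)) ?_
    (tendstoInMeasure_of_tendsto_Lp hfst) fun n => Lp.aestronglyMeasurable _
  filter_upwards [hsnd.eventually (gt_mem_nhds hC)] with n hn
  exact (hS _ (mem_testGraph_of_mem_span (hw n))).trans hn.le

/-! ### The nonlinearity -/

theorem holderTriple_coe {a b c : ℝ≥0} (ha : 0 < a) (hb : 0 < b) (hc : 0 < c)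
    (h : (a : ℝ)⁻¹ + (b : ℝ)⁻¹ = (c : ℝ)⁻¹) : ENNReal.HolderTriple a b c := by
  refine ⟨?_⟩
  rw [← ENNReal.coe_inv ha.ne', ← ENNReal.coe_inv hb.ne', ← ENNReal.coe_inv hc.ne',
    ← ENNReal.coe_add, ENNReal.coe_inj]
  exact_mod_cast h

theorem sobolevExponent_pos {N : ℕ} (hN : 3 ≤ N) : 0 < sobolevExponent N := by
  have : (3 : ℝ) ≤ N := by exact_mod_cast hN
  rw [← NNReal.coe_pos, coe_sobolevExponent hN]
  exact div_pos (by linarith) (by linarith)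

/-- The Hölder inequality with exponents `N/2`, `2*`, `2*`. -/
theorem integrable_mul_mul_and_integral_le {N : ℕ} (hN : 3 ≤ N) {μ : Measure (Space N)}
    {W w φ : Space N → ℝ} (hW : MemLp W ((N / 2 : ℝ≥0) : ℝ≥0∞) μ)
    (hw : MemLp w (sobolevExponent N) μ) (hφ : MemLp φ (sobolevExponent N) μ) :
    Integrable (fun x => W x * (w x * φ x)) μ ∧
      ∫ x, ‖W x * (w x * φ x)‖ ∂μ ≤ (eLpNorm W ((N / 2 : ℝ≥0) : ℝ≥0∞) μ).toReal *
        ((eLpNorm w (sobolevExponent N) μ).toReal * (eLpNorm φ (sobolevExponent N) μ).toReal) := by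
  have hN' : (3 : ℝ) ≤ N := by exact_mod_cast hN
  have hN2 : (N : ℝ) - 2 ≠ 0 := by linarith
  have hN0 : (N : ℝ) ≠ 0 := by linarith
  have hq := sobolevExponent_pos hN
  have i1 : ENNReal.HolderTriple (sobolevExponent N) (sobolevExponent N)
      ((sobolevExponent N / 2 : ℝ≥0) : ℝ≥0∞) := by
    refine holderTriple_coe hq hq (by positivity) ?_
    push_cast
    rw [coe_sobolevExponent hN]
    field_simp
    norm_num
  have i2 : ENNReal.HolderTriple ((N / 2 : ℝ≥0) : ℝ≥0∞)
      ((sobolevExponent N / 2 : ℝ≥0) : ℝ≥0∞) ((1 : ℝ≥0) : ℝ≥0∞) := by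
    have hNpos : (0 : ℝ≥0) < N := by exact_mod_cast (by omega : 0 < N)
    refine holderTriple_coe (by positivity) (by positivity) one_pos ?_
    push_cast
    rw [coe_sobolevExponent hN]
    field_simp
    ring
  rw [ENNReal.coe_one] at i2
  have hwφ : MemLp (fun x => w x * φ x) ((sobolevExponent N / 2 : ℝ≥0) : ℝ≥0∞) μ := hφ.mul' hw
  have hall : MemLp (fun x => W x * (w x * φ x)) 1 μ := hwφ.mul' hW
  refine ⟨memLp_one_iff_integrable.1 hall, ?_⟩
  rw [integral_norm_eq_lintegral_enorm hall.1, ← eLpNorm_one_eq_lintegral_enorm,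
    ← ENNReal.toReal_mul, ← ENNReal.toReal_mul]
  have h1 := eLpNorm_smul_le_mul_eLpNorm (r := 1) hwφ.1 hW.1 (hpqr := i2)
  have h2 := eLpNorm_smul_le_mul_eLpNorm hφ.1 hw.1 (hpqr := i1)
  refine ENNReal.toReal_mono ?_ ?_
  · exact ENNReal.mul_ne_top hW.2.ne (ENNReal.mul_ne_top hw.2.ne hφ.2.ne)
  · refine h1.trans ?_
    gcongr
    exact h2

theorem rpow_le_one_add_rpow {x p q : ℝ} (hx : 0 ≤ x) (hp : 0 ≤ p) (hpq : p ≤ q) :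
    x ^ p ≤ 1 + x ^ q := by
  rcases le_total x 1 with h | h
  · linarith [Real.rpow_le_one hx h hp, Real.rpow_nonneg hx q]
  · linarith [Real.rpow_le_rpow_of_exponent_le h hpq]

/-- The critical power `|u|^{4/(N-2)}` of a function in `L^{2*}` lies in `L^{N/2}`. -/
theorem memLp_norm_rpow_critical {N : ℕ} (hN : 3 ≤ N) {μ : Measure (Space N)}
    {u : Space N → ℝ} (hu : MemLp u (sobolevExponent N) μ) :
    MemLp (fun x => ‖u x‖ ^ (4 / ((N : ℝ) - 2))) ((N / 2 : ℝ≥0) : ℝ≥0∞) μ ∧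
      (eLpNorm (fun x => ‖u x‖ ^ (4 / ((N : ℝ) - 2))) ((N / 2 : ℝ≥0) : ℝ≥0∞) μ).toReal
        = (eLpNorm u (sobolevExponent N) μ).toReal ^ (4 / ((N : ℝ) - 2)) := by
  have hN' : (3 : ℝ) ≤ N := by exact_mod_cast hN
  have hp : 0 < 4 / ((N : ℝ) - 2) := div_pos (by norm_num) (by linarith)
  have he : ((N / 2 : ℝ≥0) : ℝ≥0∞) * ENNReal.ofReal (4 / ((N : ℝ) - 2)) = sobolevExponent N := by
    rw [ENNReal.ofReal, ← ENNReal.coe_mul, ENNReal.coe_inj, ← NNReal.coe_inj,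
      coe_sobolevExponent hN]
    push_cast
    rw [Real.coe_toNNReal _ hp.le]
    have : (N : ℝ) - 2 ≠ 0 := by linarith
    field_simp
    norm_num
  have hnorm := eLpNorm_norm_rpow (μ := μ) (p := ((N / 2 : ℝ≥0) : ℝ≥0∞)) u hp
  rw [he] at hnorm
  refine ⟨⟨?_, ?_⟩, ?_⟩
  · exact (hu.1.norm.aemeasurable.pow_const _).aestronglyMeasurable
  · rw [hnorm]
    exact ENNReal.rpow_lt_top_of_nonneg hp.le hu.2.ne
  · rw [hnorm, ENNReal.toReal_rpow]

/-- With growth up to the critical exponent, `u ↦ f(u)` is Lipschitz on bounded sets of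
`H_0^1(Ω)`, with values in the dual. -/
theorem exists_abs_integral_nonlin_sub_le {N : ℕ} (hN : 3 ≤ N) {Ω : Set (Space N)}
    (hΩb : Bornology.IsBounded Ω) {f : ℝ → ℝ} (hf : Continuous f) {p : ℝ} (hp0 : 0 ≤ p)
    (hp : p ≤ 4 / ((N : ℝ) - 2))
    (hfLip : ∃ C : ℝ, ∀ u v : ℝ, |f u - f v| ≤ C * (|u| ^ p + |v| ^ p + 1) * |u - v|) (R : ℝ) :
    ∃ K : ℝ, 0 ≤ K ∧ ∀ u v φ : H10 Ω, ‖u‖ ≤ R → ‖v‖ ≤ R →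
      Integrable (fun x => (f (toL2 u x) - f (toL2 v x)) * toL2 φ x) (volume.restrict Ω) ∧
      |∫ x in Ω, (f (toL2 u x) - f (toL2 v x)) * toL2 φ x| ≤ K * ‖u - v‖ * ‖φ‖ := by
  have hN' : (3 : ℝ) ≤ N := by exact_mod_cast hN
  obtain ⟨C, hC⟩ := hfLip
  obtain ⟨S, hS⟩ := exists_sobolev hN Ω
  have : IsFiniteMeasure (volume.restrict Ω) := ⟨by simpa using hΩb.measure_lt_top⟩
  set p₀ : ℝ := 4 / ((N : ℝ) - 2) with hp₀
  have hp₀0 : 0 ≤ p₀ := hp0.trans hp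
  set r : ℝ≥0∞ := ((N / 2 : ℝ≥0) : ℝ≥0∞) with hr
  have hr1 : 1 ≤ r := by
    rw [hr, ENNReal.one_le_coe_iff, ← NNReal.coe_le_coe]
    push_cast
    linarith
  have hmem : ∀ u : H10 Ω, MemLp (toL2 u) (sobolevExponent N) (volume.restrict Ω) := fun u =>
    ⟨Lp.aestronglyMeasurable _, (hS u).trans_lt (ENNReal.mul_lt_top ENNReal.coe_lt_top
      enorm_lt_top)⟩
  have hSr : ∀ u : H10 Ω,
      (eLpNorm (toL2 u) (sobolevExponent N) (volume.restrict Ω)).toReal ≤ S * ‖u‖ := fun u => by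
    have := ENNReal.toReal_mono (ENNReal.mul_ne_top ENNReal.coe_ne_top enorm_ne_top) (hS u)
    simpa using this
  have hconst : MemLp (fun _ : Space N => (3 : ℝ)) r (volume.restrict Ω) := memLp_const 3
  set c₃ : ℝ := (eLpNorm (fun _ : Space N => (3 : ℝ)) r (volume.restrict Ω)).toReal with hc₃
  set R' := max R 0 with hR'
  refine ⟨|C| * (c₃ + (S * R') ^ p₀ + (S * R') ^ p₀) * S * S, by positivity,
    fun u v φ hu hv => ?_⟩
  obtain ⟨hu1, hu2⟩ := memLp_norm_rpow_critical hN (hmem u)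
  obtain ⟨hv1, hv2⟩ := memLp_norm_rpow_critical hN (hmem v)
  set W : Space N → ℝ := (fun _ => (3 : ℝ)) + (fun x => ‖toL2 u x‖ ^ p₀)
    + (fun x => ‖toL2 v x‖ ^ p₀) with hW
  have hWm : MemLp W r (volume.restrict Ω) := (hconst.add hu1).add hv1
  have hWn : (eLpNorm W r (volume.restrict Ω)).toReal ≤ c₃ + (S * R') ^ p₀ + (S * R') ^ p₀ := by
    have h1 : eLpNorm W r (volume.restrict Ω) ≤
        eLpNorm (fun _ : Space N => (3 : ℝ)) r (volume.restrict Ω)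
          + eLpNorm (fun x => ‖toL2 u x‖ ^ p₀) r (volume.restrict Ω)
          + eLpNorm (fun x => ‖toL2 v x‖ ^ p₀) r (volume.restrict Ω) := by
      refine (eLpNorm_add_le (hconst.1.add hu1.1) hv1.1 hr1).trans ?_
      gcongr
      exact eLpNorm_add_le hconst.1 hu1.1 hr1
    have h2 := ENNReal.toReal_mono
      (ENNReal.add_ne_top.2 ⟨ENNReal.add_ne_top.2 ⟨hconst.2.ne, hu1.2.ne⟩, hv1.2.ne⟩) h1
    rw [ENNReal.toReal_add (ENNReal.add_ne_top.2 ⟨hconst.2.ne, hu1.2.ne⟩) hv1.2.ne,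
      ENNReal.toReal_add hconst.2.ne hu1.2.ne, hu2, hv2] at h2
    have h3 : ∀ z : H10 Ω, ‖z‖ ≤ R →
        (eLpNorm (toL2 z) (sobolevExponent N) (volume.restrict Ω)).toReal ^ p₀
          ≤ (S * R') ^ p₀ := fun z hz => by
      refine Real.rpow_le_rpow ENNReal.toReal_nonneg ((hSr z).trans ?_) hp₀0
      gcongr
      exact hz.trans (le_max_left _ _)
    linarith [h3 u hu, h3 v hv]
  obtain ⟨hint, hle⟩ := integrable_mul_mul_and_integral_le hN hWm (hmem (u - v)) (hmem φ)
  have hdom : ∀ᵐ x ∂(volume.restrict Ω), ‖(f (toL2 u x) - f (toL2 v x)) * toL2 φ x‖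
      ≤ |C| * ‖W x * (toL2 (u - v) x * toL2 φ x)‖ := by
    filter_upwards [Lp.coeFn_sub (toL2 u) (toL2 v)] with x hx
    have hx' : toL2 (u - v) x = toL2 u x - toL2 v x := hx
    have hW0 : W x = 3 + |toL2 u x| ^ p₀ + |toL2 v x| ^ p₀ := rfl
    have hWnn : 0 ≤ W x := by rw [hW0]; positivity
    rw [norm_mul, norm_mul, norm_mul, hx', Real.norm_of_nonneg hWnn, ← mul_assoc, ← mul_assoc]
    refine mul_le_mul_of_nonneg_right ?_ (norm_nonneg _)
    refine (hC _ _).trans (mul_le_mul_of_nonneg_right ?_ (abs_nonneg _))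
    refine mul_le_mul (le_abs_self C) ?_ (by positivity) (abs_nonneg C)
    rw [hW0]
    linarith [rpow_le_one_add_rpow (abs_nonneg (toL2 u x)) hp0 hp,
      rpow_le_one_add_rpow (abs_nonneg (toL2 v x)) hp0 hp]
  have hmeas : AEStronglyMeasurable (fun x => (f (toL2 u x) - f (toL2 v x)) * toL2 φ x)
      (volume.restrict Ω) :=
    ((hf.comp_aestronglyMeasurable (Lp.aestronglyMeasurable _)).sub
      (hf.comp_aestronglyMeasurable (Lp.aestronglyMeasurable _))).mul (Lp.aestronglyMeasurable _)
  refine ⟨(hint.norm.const_mul _).mono' hmeas hdom, ?_⟩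
  have h4 := norm_integral_le_of_norm_le (hint.norm.const_mul _) hdom
  rw [integral_const_mul] at h4
  refine h4.trans ?_
  calc |C| * ∫ x in Ω, ‖W x * (toL2 (u - v) x * toL2 φ x)‖
      ≤ |C| * ((c₃ + (S * R') ^ p₀ + (S * R') ^ p₀) * ((S * ‖u - v‖) * (S * ‖φ‖))) := by
        refine mul_le_mul_of_nonneg_left (hle.trans ?_) (abs_nonneg _)
        exact mul_le_mul hWn (mul_le_mul (hSr _) (hSr _) ENNReal.toReal_nonneg (by positivity))
          (by positivity) (by positivity)
    _ = _ := by ring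

/-- The nonlinearity as a map from `H_0^1(Ω)` to its dual. -/
theorem exists_nonlin_dual {N : ℕ} (hN : 3 ≤ N) {Ω : Set (Space N)}
    (hΩb : Bornology.IsBounded Ω) {f : ℝ → ℝ} (hf : Continuous f) {p : ℝ} (hp0 : 0 ≤ p)
    (hp : p ≤ 4 / ((N : ℝ) - 2))
    (hfLip : ∃ C : ℝ, ∀ u v : ℝ, |f u - f v| ≤ C * (|u| ^ p + |v| ^ p + 1) * |u - v|) :
    ∃ F : H10 Ω → H10 Ω →L[ℝ] ℝ,
      (∀ u φ : H10 Ω, Integrable (fun x => f (toL2 u x) * toL2 φ x) (volume.restrict Ω)) ∧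
      (∀ u φ, F u φ = pairNonlin f (toL2 u) (toL2 φ)) ∧
      ∀ R, ∃ K : ℝ, 0 ≤ K ∧ ∀ u v, ‖u‖ ≤ R → ‖v‖ ≤ R → ‖F u - F v‖ ≤ K * ‖u - v‖ := by
  have : IsFiniteMeasure (volume.restrict Ω) := ⟨by simpa using hΩb.measure_lt_top⟩
  have hLip := exists_abs_integral_nonlin_sub_le hN hΩb hf hp0 hp hfLip
  have hzero : ((toL2 (0 : H10 Ω)) : Space N → ℝ) =ᵐ[volume.restrict Ω] 0 := Lp.coeFn_zero ..
  have hcφ : ∀ φ : H10 Ω, Integrable (fun x => f 0 * toL2 φ x) (volume.restrict Ω) := fun φ =>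
    ((Lp.memLp (toL2 φ)).integrable one_le_two).const_mul _
  have hsplit : ∀ u φ : H10 Ω, (fun x => f (toL2 u x) * toL2 φ x) =ᵐ[volume.restrict Ω]
      fun x => (f (toL2 u x) - f (toL2 (0 : H10 Ω) x)) * toL2 φ x + f 0 * toL2 φ x :=
    fun u φ => by
      filter_upwards [hzero] with x hx
      rw [hx, Pi.zero_apply]; ring
  have hint : ∀ u φ : H10 Ω,
      Integrable (fun x => f (toL2 u x) * toL2 φ x) (volume.restrict Ω) := fun u φ => by
    obtain ⟨K, -, hK⟩ := hLip ‖u‖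
    exact (((hK u 0 φ le_rfl (by simp)).1).add (hcφ φ)).congr (hsplit u φ).symm
  -- the constant function `f 0` as an element of `L²(Ω)`
  set c : L2 Ω := (memLp_const (f 0) : MemLp (fun _ : Space N => f 0) 2 (volume.restrict Ω)).toLp
    with hc
  have hcint : ∀ φ : H10 Ω, |∫ x in Ω, f 0 * toL2 φ x| ≤ ‖c‖ * ‖φ‖ := fun φ => by
    have h1 : ∫ x in Ω, f 0 * toL2 φ x = inner ℝ c (toL2 φ) := by
      rw [L2.inner_def]
      refine integral_congr_ae ?_
      filter_upwards [MemLp.coeFn_toLp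
        (memLp_const (f 0) : MemLp (fun _ : Space N => f 0) 2 (volume.restrict Ω))] with x hx
      rw [hc, hx]
      simp [mul_comm]
    rw [h1]
    exact (abs_real_inner_le_norm _ _).trans
      (mul_le_mul_of_nonneg_left (norm_toL2_le φ) (norm_nonneg _))
  have hbound : ∀ u : H10 Ω, ∃ B, ∀ φ : H10 Ω,
      |pairNonlin f (toL2 u) (toL2 φ)| ≤ B * ‖φ‖ := fun u => by
    obtain ⟨K, -, hK⟩ := hLip ‖u‖
    refine ⟨K * ‖u - 0‖ + ‖c‖, fun φ => ?_⟩
    obtain ⟨h1, h2⟩ := hK u 0 φ le_rfl (by simp)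
    rw [pairNonlin, integral_congr_ae (hsplit u φ), integral_add h1 (hcφ φ)]
    refine (abs_add_le _ _).trans ?_
    rw [add_mul]
    exact add_le_add h2 (hcint φ)
  choose B hB using hbound
  refine ⟨fun u => LinearMap.mkContinuous
    { toFun := fun φ => pairNonlin f (toL2 u) (toL2 φ)
      map_add' := fun φ χ => ?_
      map_smul' := fun r φ => ?_ } (B u) (hB u), hint, fun u φ => rfl, fun R => ?_⟩
  · rw [pairNonlin, pairNonlin, pairNonlin, ← integral_add (hint u φ) (hint u χ)]
    refine integral_congr_ae ?_
    filter_upwards [Lp.coeFn_add (toL2 φ) (toL2 χ)] with x hx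
    have hx' : toL2 (φ + χ) x = toL2 φ x + toL2 χ x := hx
    rw [hx', mul_add]
  · rw [pairNonlin, pairNonlin, RingHom.id_apply, smul_eq_mul, ← integral_const_mul]
    refine integral_congr_ae ?_
    filter_upwards [Lp.coeFn_smul r (toL2 φ)] with x hx
    have hx' : toL2 (r • φ) x = r * toL2 φ x := hx
    rw [hx']; ring
  · obtain ⟨K, hK0, hK⟩ := hLip R
    refine ⟨K, hK0, fun u v hu hv => ?_⟩
    refine ContinuousLinearMap.opNorm_le_bound _ (by positivity) fun φ => ?_
    have h1 := (hK u v φ hu hv).2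
    simp_rw [sub_mul] at h1
    rw [integral_sub (hint u φ) (hint v φ)] at h1
    exact h1

/-- A one-sided linear bound on `f(s) s`, which is all that the a priori estimate needs from the
dissipativity condition at infinity. -/
theorem exists_mul_self_le {f : ℝ → ℝ} (hf : Continuous f) {l : ℝ}
    (hfsup : limsup (fun s : ℝ => ((f s / s : ℝ) : EReal)) (cocompact ℝ) < (l : EReal)) :
    ∃ K : ℝ, 0 ≤ K ∧ ∀ s, f s * s ≤ K * (s ^ 2 + 1) := by
  have h1 : ∀ᶠ s in cocompact ℝ, f s / s < l := by
    filter_upwards [eventually_lt_of_limsup_lt hfsup] with s hs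
    exact_mod_cast hs
  obtain ⟨t, ht, hts⟩ := mem_cocompact.1 h1
  obtain ⟨D, hD⟩ := ht.exists_bound_of_continuousOn (f := fun s => f s * s)
    (by fun_prop : Continuous fun s => f s * s).continuousOn
  refine ⟨max |l| |D|, (abs_nonneg l).trans (le_max_left _ _), fun s => ?_⟩
  have hl := le_max_left |l| |D|
  have hr := le_max_right |l| |D|
  have hs2 := sq_nonneg s
  by_cases hs : s ∈ t
  · have := (le_abs_self _).trans (hD s hs)
    nlinarith [le_abs_self D, abs_nonneg l]
  · have h2 : f s / s < l := hts hs
    rcases eq_or_ne s 0 with rfl | hs0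
    · simp
    · have h3 : f s * s = f s / s * s ^ 2 := by field_simp
      rw [h3]
      nlinarith [le_abs_self l, abs_nonneg l]

theorem integral_sq_eq_norm_sq {N : ℕ} {Ω : Set (Space N)} (u : L2 Ω) :
    ∫ x in Ω, u x ^ 2 = ‖u‖ ^ 2 := by
  rw [← real_inner_self_eq_norm_sq, L2.inner_def]
  refine integral_congr_ae (Eventually.of_forall fun x => ?_)
  simp [sq]

theorem pairNonlin_self_le {N : ℕ} {Ω : Set (Space N)} (hΩb : Bornology.IsBounded Ω) {f : ℝ → ℝ}
    {K : ℝ} (hK : ∀ s, f s * s ≤ K * (s ^ 2 + 1)) (u : L2 Ω)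
    (hint : Integrable (fun x => f (u x) * u x) (volume.restrict Ω)) :
    pairNonlin f u u ≤ K * (‖u‖ ^ 2 + volume.real Ω) := by
  have : IsFiniteMeasure (volume.restrict Ω) := ⟨by simpa using hΩb.measure_lt_top⟩
  have h1 : Integrable (fun x => u x ^ 2) (volume.restrict Ω) := (Lp.memLp u).integrable_sq
  calc pairNonlin f u u ≤ ∫ x in Ω, K * (u x ^ 2 + 1) :=
        integral_mono hint ((h1.add (integrable_const 1)).const_mul K) fun x => hK _
    _ = _ := by
        rw [integral_const_mul, integral_add h1 (integrable_const 1), integral_sq_eq_norm_sq]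
        simp

theorem functionalL_eq_inner {N : ℕ} {Ω : Set (Space N)} (g u : L2 Ω) :
    functionalL g u = inner ℝ g u := by
  rw [functionalL, L2.inner_def]
  refine integral_congr_ae (Eventually.of_forall fun x => ?_)
  simp [mul_comm]

/-! ### The force as an element of the dual space -/

theorem mul_norm_sq_le_normSqH {N : ℕ} {Ω : Set (Space N)} {ε : ℝ → ℝ} {t c : ℝ} (hc1 : c ≤ 1)
    (hcε : c ≤ ε t) (u : H10 Ω) : c * ‖u‖ ^ 2 ≤ normSqH ε t u := by
  rw [H10_norm_sq, normSqH]
  nlinarith [sq_nonneg ‖toL2 u‖, sq_nonneg ‖weakGrad u‖]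

theorem continuousOn_of_continuousInH {N : ℕ} {Ω : Set (Space N)} {ε : ℝ → ℝ} {τ : ℝ}
    (hε : ∀ t, 0 < ε t) {u : ℝ → H10 Ω} (hu : ContinuousInH ε τ u) : ContinuousOn u (Ici τ) := by
  intro t ht
  set c := min 1 (ε t) with hc
  have hc0 : 0 < c := lt_min one_pos (hε t)
  have h1 : Tendsto (fun s => √(normSqH ε t (u s - u t) / c)) (𝓝[Ici τ] t) (𝓝 0) := by
    have := ((hu t ht).div_const c).sqrt
    simpa using this
  refine tendsto_iff_norm_sub_tendsto_zero.2 (squeeze_zero (fun _ => norm_nonneg _)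
    (fun s => ?_) h1)
  refine Real.le_sqrt_of_sq_le ?_
  rw [le_div_iff₀ hc0, mul_comm]
  exact mul_norm_sq_le_normSqH (min_le_left _ _) (min_le_right _ _) _

/-- The part of the equation depending on the solution, as an element of the dual of `H_0^1(Ω)`:
`κ a(l_g(u)) Δu - ε' Δu + κ f(u)`, where `F u` represents `f(u)`. -/
noncomputable def dualForce {N : ℕ} {Ω : Set (Space N)} (κ : ℝ) (ε a : ℝ → ℝ) (g : L2 Ω)
    (F : H10 Ω → H10 Ω →L[ℝ] ℝ) (t : ℝ) (u : H10 Ω) : H10 Ω →L[ℝ] ℝ :=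
  -(κ * a (functionalL g (toL2 u)) - deriv ε t) • (innerSL ℝ (weakGradL Ω u)).comp (weakGradL Ω)
    + κ • F u

theorem dualForce_apply {N : ℕ} {Ω : Set (Space N)} (κ : ℝ) (ε a : ℝ → ℝ) (g : L2 Ω)
    (F : H10 Ω → H10 Ω →L[ℝ] ℝ) (t : ℝ) (u φ : H10 Ω) :
    dualForce κ ε a g F t u φ =
      -(κ * a (functionalL g (toL2 u)) - deriv ε t) * inner ℝ (weakGrad u) (weakGrad φ)
        + κ * F u φ := rfl

theorem continuous_of_lipschitz_on_balls {V : Type*} [NormedAddCommGroup V] [NormedSpace ℝ V]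
    {F : V → V →L[ℝ] ℝ}
    (hF : ∀ R, ∃ K : ℝ, 0 ≤ K ∧ ∀ u v, ‖u‖ ≤ R → ‖v‖ ≤ R → ‖F u - F v‖ ≤ K * ‖u - v‖) :
    Continuous F := by
  refine continuous_iff_continuousAt.2 fun v => ?_
  obtain ⟨K, -, hK⟩ := hF (‖v‖ + 1)
  refine continuousAt_of_locally_lipschitz one_pos K fun u hu => ?_
  rw [dist_eq_norm] at hu ⊢
  rw [dist_eq_norm]
  refine hK u v ?_ (by linarith)
  linarith [norm_le_norm_add_norm_sub' u v]

theorem continuousOn_dualForce {N : ℕ} {Ω : Set (Space N)} (κ : ℝ) {ε a : ℝ → ℝ}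
    (hε : ContDiff ℝ 1 ε) (ha : Continuous a) (g : L2 Ω) {F : H10 Ω → H10 Ω →L[ℝ] ℝ}
    (hF : Continuous F) {u : ℝ → H10 Ω} {s : Set ℝ} (hu : ContinuousOn u s) :
    ContinuousOn (fun t => dualForce κ ε a g F t (u t)) s := by
  have hεc : Continuous (deriv ε) := hε.continuous_deriv le_rfl
  have h1 : ContinuousOn (fun t => a (functionalL g (toL2 (u t)))) s := by
    simp_rw [functionalL_eq_inner, ← toL2L_apply]
    exact ha.comp_continuousOn
      (continuousOn_const.inner ((toL2L Ω).continuous.comp_continuousOn hu))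
  have h2 : ContinuousOn
      (fun t => (innerSL ℝ (weakGradL Ω (u t))).comp (weakGradL Ω)) s :=
    ((innerSL ℝ).continuous.comp_continuousOn
      ((weakGradL Ω).continuous.comp_continuousOn hu)).clm_comp continuousOn_const
  exact (((continuousOn_const.mul h1).sub hεc.continuousOn).neg.smul h2).add
    ((hF.comp_continuousOn hu).const_smul κ)

/-- On bounded sets of `H_0^1(Ω)`, `dualForce` is Lipschitz, uniformly in time. -/
theorem exists_dualForce_lipschitz {N : ℕ} {Ω : Set (Space N)} {κ : ℝ} (hκ : 0 ≤ κ)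
    {ε a : ℝ → ℝ} {L M : ℝ} (hε : ∀ t, |deriv ε t| ≤ L) (ha : LocallyLipschitz a)
    (haM : ∀ s, |a s| ≤ M) (g : L2 Ω) {F : H10 Ω → H10 Ω →L[ℝ] ℝ}
    (hF : ∀ R, ∃ K : ℝ, 0 ≤ K ∧ ∀ u v, ‖u‖ ≤ R → ‖v‖ ≤ R → ‖F u - F v‖ ≤ K * ‖u - v‖) (R : ℝ) :
    ∃ K : ℝ, 0 ≤ K ∧ ∀ t u v, ‖u‖ ≤ R → ‖v‖ ≤ R →
      ‖dualForce κ ε a g F t u - dualForce κ ε a g F t v‖ ≤ K * ‖u - v‖ := by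
  obtain ⟨K, hK0, hK⟩ := hF R
  obtain ⟨A, hA⟩ := (ha.locallyLipschitzOn
    (s := Icc (-(‖g‖ * R)) (‖g‖ * R))).exists_lipschitzOnWith_of_compact isCompact_Icc
  have hL0 : 0 ≤ L := (abs_nonneg _).trans (hε 0)
  have hM0 : 0 ≤ M := (abs_nonneg _).trans (haM 0)
  refine ⟨(κ * M + L) + κ * (A * ‖g‖) * |R| + κ * K, by positivity, fun t u v hu hv => ?_⟩
  have hl : ∀ z : H10 Ω, |functionalL g (toL2 z)| ≤ ‖g‖ * ‖z‖ := fun z => by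
    rw [functionalL_eq_inner]
    exact (abs_real_inner_le_norm _ _).trans
      (mul_le_mul_of_nonneg_left (norm_toL2_le z) (norm_nonneg _))
  have hmem : ∀ z : H10 Ω, ‖z‖ ≤ R →
      functionalL g (toL2 z) ∈ Icc (-(‖g‖ * R)) (‖g‖ * R) := fun z hz =>
    abs_le.1 ((hl z).trans (mul_le_mul_of_nonneg_left hz (norm_nonneg _)))
  have haL : |a (functionalL g (toL2 u)) - a (functionalL g (toL2 v))| ≤ A * ‖g‖ * ‖u - v‖ := by
    have h1 := hA.dist_le_mul _ (hmem u hu) _ (hmem v hv)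
    rw [Real.dist_eq, Real.dist_eq] at h1
    have h2 : functionalL g (toL2 u) - functionalL g (toL2 v) = functionalL g (toL2 (u - v)) := by
      simp_rw [functionalL_eq_inner, ← toL2L_apply]
      rw [map_sub, inner_sub_right]
    rw [h2] at h1
    rw [mul_assoc]
    exact h1.trans (mul_le_mul_of_nonneg_left (hl _) A.2)
  refine ContinuousLinearMap.opNorm_le_bound _ (by positivity) fun φ => ?_
  have hin : ∀ z χ : H10 Ω, |inner ℝ (weakGrad z) (weakGrad χ)| ≤ ‖z‖ * ‖χ‖ := fun z χ =>
    (abs_real_inner_le_norm _ _).trans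
      (mul_le_mul (norm_weakGrad_le z) (norm_weakGrad_le χ) (norm_nonneg _) (norm_nonneg _))
  have hsub : inner ℝ (weakGrad u) (weakGrad φ) =
      inner ℝ (weakGrad (u - v)) (weakGrad φ) + inner ℝ (weakGrad v) (weakGrad φ) := by
    simp_rw [← weakGradL_apply]
    rw [← inner_add_left, ← map_add, sub_add_cancel]
  have heq : (dualForce κ ε a g F t u - dualForce κ ε a g F t v) φ =
      -(κ * a (functionalL g (toL2 u)) - deriv ε t) * inner ℝ (weakGrad (u - v)) (weakGrad φ)
      - κ * (a (functionalL g (toL2 u)) - a (functionalL g (toL2 v)))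
          * inner ℝ (weakGrad v) (weakGrad φ)
      + κ * (F u - F v) φ := by
    rw [sub_apply, sub_apply, dualForce_apply, dualForce_apply, hsub]
    ring
  have b1 : |-(κ * a (functionalL g (toL2 u)) - deriv ε t)
      * inner ℝ (weakGrad (u - v)) (weakGrad φ)| ≤ (κ * M + L) * (‖u - v‖ * ‖φ‖) := by
    rw [abs_mul, abs_neg]
    refine mul_le_mul ((abs_sub _ _).trans (add_le_add ?_ (hε t))) (hin _ _) (abs_nonneg _)
      (by positivity)
    rw [abs_mul, abs_of_nonneg hκ]
    exact mul_le_mul_of_nonneg_left (haM _) hκ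
  have b2 : |κ * (a (functionalL g (toL2 u)) - a (functionalL g (toL2 v)))
      * inner ℝ (weakGrad v) (weakGrad φ)| ≤ κ * (A * ‖g‖ * ‖u - v‖) * (|R| * ‖φ‖) := by
    rw [abs_mul, abs_mul, abs_of_nonneg hκ]
    refine mul_le_mul (mul_le_mul_of_nonneg_left haL hκ) ((hin _ _).trans ?_) (abs_nonneg _)
      (by positivity)
    exact mul_le_mul_of_nonneg_right (hv.trans (le_abs_self R)) (norm_nonneg _)
  have b3 : |κ * (F u - F v) φ| ≤ κ * (K * ‖u - v‖ * ‖φ‖) := by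
    rw [abs_mul, abs_of_nonneg hκ]
    exact mul_le_mul_of_nonneg_left ((F u - F v).le_of_opNorm_le (hK u v hu hv) φ) hκ
  rw [heq, Real.norm_eq_abs]
  refine (abs_add_le _ _).trans ((add_le_add ((abs_sub _ _).trans (add_le_add b1 b2)) b3).trans
    (le_of_eq ?_))
  ring

/-! ### Weak solutions in integrated form -/

theorem integrableOn_Ioi_mul_of_hasCompactSupport {G ψ : ℝ → ℝ} {τ : ℝ}
    (hG : ∀ T, IntegrableOn G (Icc τ T)) (hψ : Continuous ψ) (hψc : HasCompactSupport ψ) :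
    IntegrableOn (fun t => G t * ψ t) (Ioi τ) := by
  obtain ⟨T, hT⟩ := hψc.bddAbove
  refine ((hG T).mul_continuousOn hψ.continuousOn isCompact_Icc).of_forall_sdiff_eq_zero
    measurableSet_Ioi fun t ht => ?_
  have : t ∉ tsupport ψ := fun h => ht.2 ⟨le_of_lt ht.1, hT h⟩
  rw [image_eq_zero_of_notMem_tsupport this, mul_zero]

/-- A weak solution satisfies the equation integrated in time, tested with a fixed element of
`H_0^1(Ω)`. -/
theorem inner_sub_eq_integral_of_isWeakSolution {N : ℕ} {Ω : Set (Space N)} {κ : ℝ} {ε a f : ℝ → ℝ}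
    {g : L2 Ω} {ξ : ℝ} {h : ℝ → L2 Ω} {τ : ℝ} {uτ : H10 Ω} {u : ℝ → H10 Ω}
    (hu : IsWeakSolution κ ε a f g ξ h τ uτ u) (hε : ContDiff ℝ 1 ε) (hεpos : ∀ t, 0 < ε t)
    (ha : Continuous a) {F : H10 Ω → H10 Ω →L[ℝ] ℝ} (hF : Continuous F)
    (hFf : ∀ u φ, F u φ = pairNonlin f (toL2 u) (toL2 φ)) (hh : MemL2Loc h)
    (φ : H10 Ω) {s t : ℝ} (hs : τ ≤ s) (hst : s ≤ t) :
    (inner ℝ (toL2 (u t)) (toL2 φ) + ε t * inner ℝ (weakGrad (u t)) (weakGrad φ))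
      - (inner ℝ (toL2 (u s)) (toL2 φ) + ε s * inner ℝ (weakGrad (u s)) (weakGrad φ))
      = ∫ r in s..t, (dualForce κ ε a g F r (u r) φ + inner ℝ ((κ * ξ) • h r) (toL2 φ)) := by
  have huc := continuousOn_of_continuousInH hεpos hu.continuous
  have hεc : Continuous (deriv ε) := hε.continuous_deriv le_rfl
  have hP : ContinuousOn (fun t => inner ℝ (toL2 (u t)) (toL2 φ)) (Ici τ) :=
    ((toL2L Ω).continuous.comp_continuousOn huc).inner continuousOn_const
  have hQ : ContinuousOn (fun t => inner ℝ (weakGrad (u t)) (weakGrad φ)) (Ici τ) :=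
    ((weakGradL Ω).continuous.comp_continuousOn huc).inner continuousOn_const
  have hal : ContinuousOn (fun t => a (functionalL g (toL2 (u t)))) (Ici τ) := by
    simp_rw [functionalL_eq_inner]
    exact ha.comp_continuousOn
      (continuousOn_const.inner ((toL2L Ω).continuous.comp_continuousOn huc))
  have hA : ∀ T, IntegrableOn (fun t => (κ * a (functionalL g (toL2 (u t))) - deriv ε t)
      * inner ℝ (weakGrad (u t)) (weakGrad φ)) (Icc τ T) := fun T =>
    ((((continuousOn_const.mul hal).sub hεc.continuousOn).mul hQ).mono
      Icc_subset_Ici_self).integrableOn_compact isCompact_Icc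
  have hFu : ContinuousOn (fun t => pairNonlin f (toL2 (u t)) (toL2 φ)) (Ici τ) := by
    simp_rw [← hFf]
    exact (hF.comp_continuousOn huc).clm_apply continuousOn_const
  have hB : ∀ T, IntegrableOn (fun t => κ * pairNonlin f (toL2 (u t)) (toL2 φ)
      + κ * ξ * inner ℝ (h t) (toL2 φ)) (Icc τ T) := fun T =>
    (((hFu.mono Icc_subset_Ici_self).integrableOn_compact isCompact_Icc).const_mul κ).add
      ((((hh τ T).integrable one_le_two).inner_const (toL2 φ)).const_mul (κ * ξ))
  have key := sub_eq_integral_of_weak_deriv (hP.add (hε.continuous.continuousOn.mul hQ))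
    (fun T => (hB T).sub (hA T)) (fun ψ h1 h2 h3 => ?_) hs hst
  · refine key.trans (intervalIntegral.integral_congr fun r _ => ?_)
    simp only [dualForce_apply, real_inner_smul_left, hFf, Pi.sub_apply]
    ring
  · have hw := hu.weak φ ψ h1 h2 h3
    simp only [Pi.sub_apply, Pi.add_apply, Pi.mul_apply]
    simp_rw [sub_mul (κ * pairNonlin f _ _ + _)]
    rw [integral_sub (integrableOn_Ioi_mul_of_hasCompactSupport hB h1.continuous h2)
      (integrableOn_Ioi_mul_of_hasCompactSupport hA h1.continuous h2)]
    linarith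

theorem continuousOn_normSqH {N : ℕ} {Ω : Set (Space N)} {ε : ℝ → ℝ} (hε : Continuous ε)
    {u : ℝ → H10 Ω} {s : Set ℝ} (hu : ContinuousOn u s) :
    ContinuousOn (fun t => normSqH ε t (u t)) s :=
  (((toL2L Ω).continuous.comp_continuousOn hu).norm.pow 2).add
    (hε.continuousOn.mul (((weakGradL Ω).continuous.comp_continuousOn hu).norm.pow 2))

/-! ### A priori bound and continuous dependence -/

/-- The a priori bound: on `[τ, T]`, weak solutions are bounded in `H_0^1(Ω)` in terms of their
initial energy only. -/
theorem exists_norm_le_of_isWeakSolution {N : ℕ} {Ω : Set (Space N)}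
    (hΩb : Bornology.IsBounded Ω) {κ : ℝ} (hκ : 0 ≤ κ) {ε a f : ℝ → ℝ} (hε : ContDiff ℝ 1 ε)
    (hεpos : ∀ t, 0 < ε t) (hεdec : Antitone ε) (ha : Continuous a) (ha0 : ∀ s, 0 ≤ a s)
    {g : L2 Ω} {F : H10 Ω → H10 Ω →L[ℝ] ℝ} (hF : Continuous F)
    (hint : ∀ u φ : H10 Ω, Integrable (fun x => f (toL2 u x) * toL2 φ x) (volume.restrict Ω))
    (hFf : ∀ u φ, F u φ = pairNonlin f (toL2 u) (toL2 φ))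
    {K : ℝ} (hK0 : 0 ≤ K) (hK : ∀ s, f s * s ≤ K * (s ^ 2 + 1))
    {ξ : ℝ} (hξ : 0 ≤ ξ) {h : ℝ → L2 Ω} (hh : MemL2Loc h) (τ T R : ℝ) :
    ∃ B : ℝ, ∀ (uτ : H10 Ω) (u : ℝ → H10 Ω), IsWeakSolution κ ε a f g ξ h τ uτ u →
      normSqH ε τ uτ ≤ R → ∀ t ∈ Icc τ T, ‖u t‖ ≤ B := by
  set V := volume.real Ω with hV
  set C := 2 * κ * K + κ * ξ with hC
  set k : ℝ → ℝ := fun r => 2 * κ * K * V + κ * ξ * ‖h r‖ ^ 2 with hk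
  have hC0 : 0 ≤ C := by positivity
  have hV0 : 0 ≤ V := measureReal_nonneg
  have hk0 : ∀ r, 0 ≤ k r := fun r => by positivity
  have hkint : ∀ b, IntegrableOn k (Icc τ b) := fun b =>
    (integrable_const _).add (((hh τ b).integrable_norm_pow two_ne_zero).const_mul _)
  set c := min 1 (ε T) with hc
  have hc0 : 0 < c := lt_min one_pos (hεpos T)
  refine ⟨√((R + ∫ r in τ..T, k r) * Real.exp (C * (T - τ)) / c), fun uτ u hu hR t ht => ?_⟩
  have huc : ContinuousOn u (Icc τ T) :=
    (continuousOn_of_continuousInH hεpos hu.continuous).mono Icc_subset_Ici_self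
  have hy : ContinuousOn (fun t => normSqH ε t (u t)) (Icc τ T) :=
    continuousOn_normSqH hε.continuous huc
  have hy0 : ∀ t, 0 ≤ normSqH ε t (u t) := fun t =>
    add_nonneg (sq_nonneg _) (mul_nonneg (hεpos t).le (sq_nonneg _))
  have hineq : ∀ t ∈ Icc τ T, normSqH ε t (u t) ≤
      (R + ∫ r in τ..T, k r) + C * ∫ r in τ..t, normSqH ε r (u r) := by
    intro t ht
    obtain ⟨hEint, hE⟩ := energy_identity (toL2L Ω) (weakGradL Ω) hε ht.1
      (huc.mono (Icc_subset_Icc_right ht.2))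
      ((continuousOn_dualForce κ hε ha g hF huc).mono (Icc_subset_Icc_right ht.2))
      (((hh τ t).integrable one_le_two).smul (κ * ξ))
      (fun φ s r hs hsr _ =>
        inner_sub_eq_integral_of_isWeakSolution hu hε hεpos ha hF hFf hh φ hs hsr)
    simp only [toL2L_apply, weakGradL_apply] at hE hEint
    have hii : ∀ {q : ℝ → ℝ}, IntegrableOn q (Icc τ t) → IntervalIntegrable q volume τ t :=
      fun hq => (intervalIntegrable_iff_integrableOn_Icc_of_le ht.1).2 hq
    have hyint : IntegrableOn (fun r => normSqH ε r (u r)) (Icc τ t) :=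
      (hy.mono (Icc_subset_Icc_right ht.2)).integrableOn_compact isCompact_Icc
    have hmono := intervalIntegral.integral_mono_on ht.1 (hii hEint)
      ((hii (hkint t)).add ((hii hyint).const_mul C)) fun r _ => ?_
    · rw [intervalIntegral.integral_add (hii (hkint t)) ((hii hyint).const_mul C),
        intervalIntegral.integral_const_mul] at hmono
      have hkm : ∫ r in τ..t, k r ≤ ∫ r in τ..T, k r :=
        intervalIntegral.integral_mono_interval le_rfl ht.1 ht.2
          (Eventually.of_forall hk0)
          ((intervalIntegrable_iff_integrableOn_Icc_of_le (ht.1.trans ht.2)).2 (hkint T))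
      have hRτ : normSqH ε τ (u τ) ≤ R := by rw [hu.initial]; exact hR
      simp only [normSqH] at hRτ hmono ⊢
      linarith
    · have h1 : F (u r) (u r) ≤ K * (‖toL2 (u r)‖ ^ 2 + V) := by
        rw [hFf]
        exact pairNonlin_self_le hΩb hK _ (hint _ _)
      have h2 : inner ℝ (h r) (toL2 (u r)) ≤ (‖h r‖ ^ 2 + ‖toL2 (u r)‖ ^ 2) / 2 := by
        have := real_inner_le_norm (h r) (toL2 (u r))
        nlinarith [sq_nonneg (‖h r‖ - ‖toL2 (u r)‖)]
      have h3 : 0 ≤ κ * a (functionalL g (toL2 (u r))) * ‖weakGrad (u r)‖ ^ 2 := by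
        have := ha0 (functionalL g (toL2 (u r)))
        positivity
      have h4 : deriv ε r * ‖weakGrad (u r)‖ ^ 2 ≤ 0 :=
        mul_nonpos_of_nonpos_of_nonneg hεdec.deriv_nonpos (sq_nonneg _)
      have h5 : 0 ≤ C * (ε r * ‖weakGrad (u r)‖ ^ 2) := by
        have := (hεpos r).le
        positivity
      have h6 := mul_le_mul_of_nonneg_left h1 hκ
      have h7 := mul_le_mul_of_nonneg_left h2 (mul_nonneg hκ hξ)
      simp only [dualForce_apply, real_inner_smul_left, real_inner_self_eq_norm_sq, normSqH, hk,
        Pi.smul_apply]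
      simp only [hC] at h5 ⊢
      linarith
  have hbound := le_mul_exp_of_le_integral hC0 hy hineq t ht
  have hD0 : 0 ≤ R + ∫ r in τ..T, k r := by
    have h1 : 0 ≤ R := by
      refine le_trans ?_ hR
      rw [← hu.initial]
      exact hy0 τ
    have h2 : 0 ≤ ∫ r in τ..T, k r :=
      intervalIntegral.integral_nonneg (ht.1.trans ht.2) fun r _ => hk0 r
    linarith
  refine Real.le_sqrt_of_sq_le ?_
  rw [le_div_iff₀ hc0, mul_comm]
  refine (mul_norm_sq_le_normSqH (min_le_left _ _) ((min_le_right _ _).trans (hεdec ht.2)) _).trans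
    (hbound.trans (mul_le_mul_of_nonneg_left (Real.exp_le_exp.2 ?_) hD0))
  exact mul_le_mul_of_nonneg_left (by linarith [ht.2]) hC0

/-- Two weak solutions that stay in a ball on which `dualForce` is `K`-Lipschitz depend
continuously on their initial values. The external force drops out of their difference. -/
theorem normSqH_sub_le {N : ℕ} {Ω : Set (Space N)} {κ : ℝ} {ε a f : ℝ → ℝ} (hε : ContDiff ℝ 1 ε)
    (hεpos : ∀ t, 0 < ε t) (hεdec : Antitone ε) {L : ℝ} (hεL : ∀ t, |deriv ε t| ≤ L)
    (ha : Continuous a) {g : L2 Ω} {F : H10 Ω → H10 Ω →L[ℝ] ℝ} (hF : Continuous F)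
    (hFf : ∀ u φ, F u φ = pairNonlin f (toL2 u) (toL2 φ))
    {ξ : ℝ} {h : ℝ → L2 Ω} (hh : MemL2Loc h) {τ T B K : ℝ} (hK0 : 0 ≤ K)
    (hK : ∀ t u v, ‖u‖ ≤ B → ‖v‖ ≤ B →
      ‖dualForce κ ε a g F t u - dualForce κ ε a g F t v‖ ≤ K * ‖u - v‖)
    {uτ₁ uτ₂ : H10 Ω} {u₁ u₂ : ℝ → H10 Ω} (hu₁ : IsWeakSolution κ ε a f g ξ h τ uτ₁ u₁)
    (hu₂ : IsWeakSolution κ ε a f g ξ h τ uτ₂ u₂) (hB₁ : ∀ t ∈ Icc τ T, ‖u₁ t‖ ≤ B)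
    (hB₂ : ∀ t ∈ Icc τ T, ‖u₂ t‖ ≤ B) :
    ∀ t ∈ Icc τ T, normSqH ε t (u₁ t - u₂ t) ≤
      Real.exp ((2 * K + L) / min 1 (ε T) * (t - τ)) * normSqH ε τ (uτ₁ - uτ₂) := by
  intro t ht
  set c := min 1 (ε T) with hc
  have hc0 : 0 < c := lt_min one_pos (hεpos T)
  have hL0 : 0 ≤ L := (abs_nonneg _).trans (hεL 0)
  have huc₁ : ContinuousOn u₁ (Icc τ T) :=
    (continuousOn_of_continuousInH hεpos hu₁.continuous).mono Icc_subset_Ici_self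
  have huc₂ : ContinuousOn u₂ (Icc τ T) :=
    (continuousOn_of_continuousInH hεpos hu₂.continuous).mono Icc_subset_Ici_self
  have hwc := huc₁.sub huc₂
  have hy : ContinuousOn (fun t => normSqH ε t (u₁ t - u₂ t)) (Icc τ T) :=
    continuousOn_normSqH hε.continuous hwc
  have hineq : ∀ t ∈ Icc τ T, normSqH ε t (u₁ t - u₂ t) ≤
      normSqH ε τ (uτ₁ - uτ₂) + (2 * K + L) / c * ∫ r in τ..t, normSqH ε r (u₁ r - u₂ r) := by
    intro t ht
    have hA₁ := (continuousOn_dualForce κ hε ha g hF huc₁).mono (Icc_subset_Icc_right ht.2)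
    have hA₂ := (continuousOn_dualForce κ hε ha g hF huc₂).mono (Icc_subset_Icc_right ht.2)
    have hhi : IntegrableOn (fun r => (κ * ξ) • h r) (Icc τ t) :=
      ((hh τ t).integrable one_le_two).smul (κ * ξ)
    have hii : ∀ {q : ℝ → ℝ} {s r : ℝ}, τ ≤ s → s ≤ r → r ≤ t → IntegrableOn q (Icc τ t) →
        IntervalIntegrable q volume s r := fun hs hsr hr hq =>
      (intervalIntegrable_iff_integrableOn_Icc_of_le hsr).2
        (hq.mono_set (Icc_subset_Icc hs hr))
    have hGint : ∀ (φ : H10 Ω) (u : ℝ → H10 Ω),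
        ContinuousOn (fun r => dualForce κ ε a g F r (u r)) (Icc τ t) →
        IntegrableOn (fun r => dualForce κ ε a g F r (u r) φ
          + inner ℝ ((κ * ξ) • h r) (toL2 φ)) (Icc τ t) := fun φ u hA =>
      ((hA.clm_apply continuousOn_const).integrableOn_compact isCompact_Icc).add
        (hhi.inner_const (toL2 φ))
    obtain ⟨hEint, hE⟩ := energy_identity (toL2L Ω) (weakGradL Ω) hε (w := fun t => u₁ t - u₂ t)
      (A := fun r => dualForce κ ε a g F r (u₁ r) - dualForce κ ε a g F r (u₂ r)) ht.1
      (hwc.mono (Icc_subset_Icc_right ht.2)) (hA₁.sub hA₂) (h := fun _ => 0) integrableOn_zero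
      (fun φ s r hs hsr hr => by
        have e₁ := inner_sub_eq_integral_of_isWeakSolution hu₁ hε hεpos ha hF hFf hh φ hs hsr
        have e₂ := inner_sub_eq_integral_of_isWeakSolution hu₂ hε hεpos ha hF hFf hh φ hs hsr
        have e₃ := intervalIntegral.integral_sub (hii hs hsr hr (hGint φ u₁ hA₁))
          (hii hs hsr hr (hGint φ u₂ hA₂))
        simp only [add_sub_add_right_eq_sub] at e₃
        simp only [sub_apply, inner_zero_left, add_zero]
        rw [e₃, ← e₁, ← e₂]
        simp only [map_sub, inner_sub_left, toL2L_apply, weakGradL_apply]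
        ring)
    have hyint : IntegrableOn (fun r => normSqH ε r (u₁ r - u₂ r)) (Icc τ t) :=
      (hy.mono (Icc_subset_Icc_right ht.2)).integrableOn_compact isCompact_Icc
    have hmono := intervalIntegral.integral_mono_on ht.1 (hii le_rfl ht.1 le_rfl hEint)
      ((hii le_rfl ht.1 le_rfl hyint).const_mul ((2 * K + L) / c)) fun r hr => ?_
    · rw [← hE, intervalIntegral.integral_const_mul, hu₁.initial, hu₂.initial] at hmono
      simp only [normSqH, toL2L_apply, weakGradL_apply] at hmono ⊢
      linarith
    · have hrT : r ∈ Icc τ T := ⟨hr.1, hr.2.trans ht.2⟩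
      have h1 : (dualForce κ ε a g F r (u₁ r) - dualForce κ ε a g F r (u₂ r)) (u₁ r - u₂ r)
          ≤ K * ‖u₁ r - u₂ r‖ * ‖u₁ r - u₂ r‖ :=
        (le_abs_self _).trans (ContinuousLinearMap.le_of_opNorm_le _
          (hK r _ _ (hB₁ r hrT) (hB₂ r hrT)) _)
      have h2 : -deriv ε r * ‖weakGrad (u₁ r - u₂ r)‖ ^ 2 ≤ L * ‖u₁ r - u₂ r‖ ^ 2 :=
        mul_le_mul ((neg_le_abs _).trans (hεL r))
          (pow_le_pow_left₀ (norm_nonneg _) (norm_weakGrad_le _) 2) (sq_nonneg _) hL0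
      have h3 : ‖u₁ r - u₂ r‖ ^ 2 ≤ normSqH ε r (u₁ r - u₂ r) / c := by
        rw [le_div_iff₀ hc0, mul_comm]
        exact mul_norm_sq_le_normSqH (min_le_left _ _) ((min_le_right _ _).trans (hεdec hrT.2)) _
      have h4 := mul_le_mul_of_nonneg_left h3 (by positivity : 0 ≤ 2 * K + L)
      have h5 : (2 * K + L) / c * normSqH ε r (u₁ r - u₂ r)
          = (2 * K + L) * (normSqH ε r (u₁ r - u₂ r) / c) := by ring
      rw [h5]
      simp only [inner_zero_left, add_zero, weakGradL_apply]
      linarith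
  rw [mul_comm]
  exact le_mul_exp_of_le_integral (by positivity) hy hineq t ht

theorem theorem3p2
    -- the domain
    (N : ℕ) (hN : 3 ≤ N) (Ω : Set (Space N))
    (hΩo : IsOpen Ω) (hΩc : IsConnected Ω) (hΩb : Bornology.IsBounded Ω)
    (hΩs : HasSmoothBoundary Ω)
    -- the coefficient `ε`
    (ε : ℝ → ℝ) (hεC : ContDiff ℝ 1 ε) (hεpos : ∀ t, 0 < ε t) (hεdec : Antitone ε)
    (hεlim : Tendsto ε atTop (𝓝 0))
    (hεbd : ∃ L : ℝ, 0 < L ∧ ∀ t, |ε t| + |deriv ε t| ≤ L)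
    -- the nonlocal diffusion coefficient
    (a : ℝ → ℝ) (ha : LocallyLipschitz a)
    (m M : ℝ) (hm : 0 < m) (ham : ∀ s, m ≤ a s ∧ a s ≤ M)
    (g : L2 Ω)
    -- the nonlinearity
    (f : ℝ → ℝ) (hf : Continuous f)
    (p : ℝ) (hp0 : 0 ≤ p) (hp : p ≤ 4 / ((N : ℝ) - 2))
    (hfLip : ∃ C : ℝ, ∀ u v : ℝ, |f u - f v| ≤ C * (|u| ^ p + |v| ^ p + 1) * |u - v|)
    (hfsup : limsup (fun s : ℝ => ((f s / s : ℝ) : EReal)) (cocompact ℝ)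
      < ((firstEigenvalue Ω : ℝ) : EReal))
    (f₀ f₁ : ℝ → ℝ) (hf₀ : Continuous f₀) (hf₁ : Continuous f₁)
    (hfdec : ∀ s, f s = f₀ s + f₁ s)
    (hf₀bd : ∃ C : ℝ, ∀ s : ℝ, |f₀ s| ≤ C * (|s| ^ (p + 1) + |s|))
    (hf₀diss : ∀ (t : ℝ) (u : H10 Ω),
      pairNonlin f₀ (toL2 u) (toL2 u) ≤
        (2 * a (functionalL g (toL2 u)) - deriv ε t
            - firstEigenvalue Ω / (firstEigenvalue Ω + 1) * ε t)
          * ‖weakGrad u‖ ^ 2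
        - firstEigenvalue Ω / (firstEigenvalue Ω + 1)
          * ‖toL2 u‖ ^ 2)
    (hf₁bd : ∃ C : ℝ, ∀ s : ℝ, |f₁ s| ≤ C * (|s| ^ (p + 1) + 1))
    -- the external force
    (ξ : ℝ) (hξ : 0 < ξ) (h : ℝ → L2 Ω) (hh : MemL2Loc h)
    -- the initial time, and the normalization of the weak form
    (τ : ℝ) (κ : ℝ) (hκ : κ = 1 ∨ κ = 2) :
    -- uniqueness
    (∀ (uτ : H10 Ω) (u₁ u₂ : ℝ → H10 Ω),
      IsWeakSolution κ ε a f g ξ h τ uτ u₁ →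
      IsWeakSolution κ ε a f g ξ h τ uτ u₂ →
      ∀ t, τ ≤ t → u₁ t = u₂ t) ∧
    -- the quantitative estimate
    (∀ T : ℝ, τ ≤ T → ∀ R : ℝ, ∃ C : ℝ,
      ∀ (uτ₁ uτ₂ : H10 Ω) (u₁ u₂ : ℝ → H10 Ω),
        IsWeakSolution κ ε a f g ξ h τ uτ₁ u₁ →
        IsWeakSolution κ ε a f g ξ h τ uτ₂ u₂ →
        normSqH ε τ uτ₁ ≤ R →
        normSqH ε τ uτ₂ ≤ R →
        ∀ t ∈ Icc τ T,
          normSqH ε t (u₁ t - u₂ t) ≤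
            Real.exp (C * (t - τ)) * normSqH ε τ (uτ₁ - uτ₂)) := by

  have hκ0 : 0 ≤ κ := by rcases hκ with rfl | rfl <;> norm_num
  obtain ⟨L, -, hL⟩ := hεbd
  have hεL : ∀ t, |deriv ε t| ≤ L := fun t => by linarith [hL t, abs_nonneg (ε t)]
  have haM : ∀ s, |a s| ≤ M := fun s => by
    rw [abs_of_pos (hm.trans_le (ham s).1)]
    exact (ham s).2
  obtain ⟨F, hint, hFf, hFLip⟩ := exists_nonlin_dual hN hΩb hf hp0 hp hfLip
  have hF := continuous_of_lipschitz_on_balls hFLip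
  obtain ⟨K₀, hK₀, hK₀f⟩ := exists_mul_self_le hf hfsup
  have main : ∀ T : ℝ, ∀ R : ℝ, ∃ C : ℝ,
      ∀ (uτ₁ uτ₂ : H10 Ω) (u₁ u₂ : ℝ → H10 Ω),
        IsWeakSolution κ ε a f g ξ h τ uτ₁ u₁ →
        IsWeakSolution κ ε a f g ξ h τ uτ₂ u₂ →
        normSqH ε τ uτ₁ ≤ R →
        normSqH ε τ uτ₂ ≤ R →
        ∀ t ∈ Icc τ T,
          normSqH ε t (u₁ t - u₂ t) ≤
            Real.exp (C * (t - τ)) * normSqH ε τ (uτ₁ - uτ₂) := by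
    intro T R
    obtain ⟨B, hB⟩ := exists_norm_le_of_isWeakSolution (g := g) hΩb hκ0 hεC hεpos hεdec
      ha.continuous (fun s => hm.le.trans (ham s).1) hF hint hFf hK₀ hK₀f hξ.le hh τ T R
    obtain ⟨K, hK0, hK⟩ := exists_dualForce_lipschitz hκ0 hεL ha haM g hFLip B
    exact ⟨_, fun uτ₁ uτ₂ u₁ u₂ hu₁ hu₂ hR₁ hR₂ =>
      normSqH_sub_le hεC hεpos hεdec hεL ha.continuous hF hFf hh hK0 hK hu₁ hu₂
        (hB _ _ hu₁ hR₁) (hB _ _ hu₂ hR₂)⟩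
  refine ⟨fun uτ u₁ u₂ hu₁ hu₂ t ht => ?_, fun T _ R => main T R⟩
  obtain ⟨C, hC⟩ := main t (normSqH ε τ uτ)
  have h1 := hC uτ uτ u₁ u₂ hu₁ hu₂ le_rfl le_rfl t ⟨ht, le_rfl⟩
  have h2 : normSqH ε τ (uτ - uτ) = 0 := by
    rw [sub_self, normSqH, ← toL2L_apply, ← weakGradL_apply, map_zero, map_zero]
    simp
  rw [h2, mul_zero] at h1
  have hc0 : 0 < min 1 (ε t) := lt_min one_pos (hεpos t)
  have h3 := (mul_norm_sq_le_normSqH (min_le_left 1 (ε t)) (min_le_right _ _) (u₁ t - u₂ t)).trans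
    h1
  have h4 : ‖u₁ t - u₂ t‖ ^ 2 ≤ 0 := nonpos_of_mul_nonpos_right h3 hc0
  have h5 : ‖u₁ t - u₂ t‖ = 0 := by nlinarith [norm_nonneg (u₁ t - u₂ t)]
  exact sub_eq_zero.1 (norm_eq_zero.1 h5)
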